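/- **Setting.** Let $\mathbb H$ be the quaternions, $\mathbb S=\{I\in\mathbb H: I^2=-1\}$, $\mathbb C=\mathbb C_i\subset\mathbb H$, and $\mathbb C^{\pm}=\{v\in\mathbb C:\pm\operatorname{Im}v>0\}$. A function $F=F_1+\imath F_2:\mathbb C\setminus\mathbb R\to\mathbb H\otimes\mathbb C$ with $F(\bar z)=\overline{F(z)}$ (where $\overline{a+\imath b}=a-\imath b$ for $a,b\in\mathbb H$) induces the slice function $\mathcal I(F)(\alpha+I\beta)=F_1(\alpha+i\beta)+I\,F_2(\alpha+i\beta)$ on $\mathbb H\setminus\mathbb R$ ($I\in\mathbb S$, $\alpha,\beta\in\mathbb R$, $\beta\ne0$), and $\mathcal I(F)*\mathcal I(G)=\mathcal I(FG)$. For $J\in\mathbb S$ put $\ell^J_{\pm}(\alpha+I\beta)=\frac{1\mp IJ}{2}$ for $\beta>0$. A *slice-polynomial function* is a function $P:\mathbb H\setminus\mathbb R\to\mathbb H$ of the form $P=P_+*\ell^J_++P_-*\ell^J_-$ with $J\in\mathbb S$ and quaternionic polynomials $P_\pm(q)=\sum_n q^n a_n^{\pm}$. Its *companion* is $P^\vee=P_-*\ell^J_++P_+*\ell^J_-$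 (it depends only on $P$), and its *extension to the real axis* is $P_{\mathbb R}(I,\alpha)=\lim_{\beta\to0^+}P(\alpha+I\beta)$, for $(I,\alpha)\in\mathbb S\times\mathbb R$. There are unique polynomials $g,\hat g,h,\hat h\in\mathbb C[v]$ with $P(v)=g(v)+h(v)j$ for $v\in\mathbb C^+$ and $P(v)=\overline{\hat g(\bar v)}+\overline{\hat h(\bar v)}\,j$ for $v\in\mathbb C^-$. The *twistor degree* of $P$ is $d=\max_{q\in\mathbb H}\deg D_q$, where, for $q=q_1+q_2j$ with $q_1,q_2\in\mathbb C$, $$D_q(v)=-(g(v)-q_1)(\bar q_1-\hat g(v))+(h(v)-q_2)(\hat h(v)-\bar q_2)$$ (the zero polynomial being given degree $0$ here). Let $\pi:\mathbb{CP}^3\to\mathbb{HP}^1$, $\pi[X_0,X_1,X_2,X_3]=[X_0+X_1j,\,X_2+X_3j]$, be the twistor fibration, where $[q_1,q_2]=[pq_1,pq_2]$ for $p\in\mathbb H\setminus\{0\}$ and $\mathbb H\subset\mathbb{HP}^1$ via $q\mapsto[1,q]$. Let $\mathcal Q$ be the part lying over $\mathbb H$ of the Segre quadric $X_0X_3=X_1X_2$,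 that is, $\mathcal Q=\{[s,u,sv,uv]:[s,u]\in\mathbb{CP}^1,\ v\in\mathbb C\}$. The *extended twistor lift* $\mathcal P:\mathcal Q\to\mathbb{CP}^3$ of $P$ sends $X=[s,u,sv,uv]$ to the point of the fibre of $\pi$ over $[1,p]$ whose first two homogeneous coordinates are $[s,u]$, where $p=P(\pi(X))$ if $v\in\mathbb C^+$, $p=P^\vee(\pi(X))$ if $v\in\mathbb C^-$, and $p=P_{\mathbb R}(I,v)$ with $I=(s+uj)^{-1}i(s+uj)$ if $v\in\mathbb R$. Explicitly, $\mathcal P[s,u,sv,uv]=[s,u,\,sg(v)-u\hat h(v),\,sh(v)+u\hat g(v)]$. **Statement.** Let $P$ be a slice-polynomial function with twistor degree $d$. Assume that $\mathcal P$ is generically $k:1$ onto its image, i.e. there is a Zariski-closed set $Z\subset\mathbb{CP}^3$ not containing $\mathcal P(\mathcal Q)$ such that every point of $\mathcal P(\mathcal Q)\setminus Z$ has exactly $k$ preimages under $\mathcal P$. Then $k$ divides $d$, and $\mathcal P(\mathcal Q)$ lies in an irreducible algebraic surface of degree $d/k$ in $\mathbb{CP}^3$. -/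

import Mathlib

open scoped Quaternion

namespace SlicePoly

noncomputable section

/-! ### Quaternions, imaginary units -/

/-- The quaternion `z + w j`, for `z w : ℂ`, where `ℂ` is identified with `ℂ_i ⊂ ℍ`. -/
def quat (z w : ℂ) : ℍ[ℝ] := ⟨z.re, z.im, w.re, w.im⟩

/-- The first complex coordinate `q₁` of `q = q₁ + q₂ j`. -/
def co1 (q : ℍ[ℝ]) : ℂ := ⟨q.re, q.imI⟩

/-- The second complex coordinate `q₂` of `q = q₁ + q₂ j`. -/
def co2 (q : ℍ[ℝ]) : ℂ := ⟨q.imJ, q.imK⟩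

/-- The sphere `𝕊` of quaternionic imaginary units. -/
def unitSphere : Set ℍ[ℝ] := {I | I * I = -1}

/-- The point `α + I β` of the slice `ℂ_I`, for `z = α + i β`. -/
def slicePt (I : ℍ[ℝ]) (z : ℂ) : ℍ[ℝ] := (z.re : ℍ[ℝ]) + z.im • I

/-! ### Stem functions and slice functions on `ℍ ∖ ℝ` -/

/-- The algebra `ℍ ⊗ ℂ`; the pair `⟨a, b⟩` stands for `a + ı b`, with `ı` central, `ı² = -1`. -/
structure HC where
  /-- the component `a` of `a + ı b` -/
  fst : ℍ[ℝ]
  /-- the component `b` of `a + ı b` -/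
  snd : ℍ[ℝ]

instance : Add HC := ⟨fun x y => ⟨x.fst + y.fst, x.snd + y.snd⟩⟩

instance : Mul HC :=
  ⟨fun x y => ⟨x.fst * y.fst - x.snd * y.snd, x.fst * y.snd + x.snd * y.fst⟩⟩

/-- `f` is, on `ℍ ∖ ℝ`, the slice function induced by the stem function `F = F₁ + ı F₂`:
`f (α + I β) = F₁ (α + i β) + I F₂ (α + i β)`. Values of `f` and `F` at real points are never
used. -/
def IsInducedBy (f : ℍ[ℝ] → ℍ[ℝ]) (F : ℂ → HC) : Prop :=
  ∀ I ∈ unitSphere, ∀ z : ℂ, z.im ≠ 0 → f (slicePt I z) = (F z).fst + I * (F z).snd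

/-- The stem function `z ↦ ∑ zⁿ aₙ` of the quaternionic polynomial `q ↦ ∑ qⁿ aₙ`
(coefficients on the right). -/
def polyStem (p : Polynomial ℍ[ℝ]) (z : ℂ) : HC :=
  ⟨p.sum fun n a => (z ^ n).re • a, p.sum fun n a => (z ^ n).im • a⟩

/-- The stem function of the slice-constant function `ℓ₊^J`. -/
def stemPlus (J : ℍ[ℝ]) (z : ℂ) : HC :=
  if 0 < z.im then ⟨(1 / 2 : ℝ) • 1, -((1 / 2 : ℝ) • J)⟩ else ⟨(1 / 2 : ℝ) • 1, (1 / 2 : ℝ) • J⟩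

/-- The stem function of the slice-constant function `ℓ₋^J`. -/
def stemMinus (J : ℍ[ℝ]) (z : ℂ) : HC :=
  if 0 < z.im then ⟨(1 / 2 : ℝ) • 1, (1 / 2 : ℝ) • J⟩ else ⟨(1 / 2 : ℝ) • 1, -((1 / 2 : ℝ) • J)⟩

/-- The stem function of `p * ℓ₊^J + m * ℓ₋^J`, where `*` is the `*`-product of slice functions,
that is, the pointwise product of stem functions. -/
def peirceStem (J : ℍ[ℝ]) (p m : Polynomial ℍ[ℝ]) (z : ℂ) : HC :=
  polyStem p z * stemPlus J z + polyStem m z * stemMinus J z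

/-- `P : ℍ ∖ ℝ → ℍ` is a slice-polynomial function: `P = P₊ * ℓ₊^J + P₋ * ℓ₋^J` for some
imaginary unit `J` and some quaternionic polynomials `P₊`, `P₋`. (Such a function is
automatically slice regular.) -/
def IsSlicePolynomial (P : ℍ[ℝ] → ℍ[ℝ]) : Prop :=
  ∃ J ∈ unitSphere, ∃ p m : Polynomial ℍ[ℝ], IsInducedBy P (peirceStem J p m)

/-- `Pv` is the companion of the slice-polynomial function `P = P₊ * ℓ₊^J + P₋ * ℓ₋^J`:
`Pv = P₋ * ℓ₊^J + P₊ * ℓ₋^J` on `ℍ ∖ ℝ`. This function depends neither on `J` nor on the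
chosen representation. -/
def IsCompanion (P Pv : ℍ[ℝ] → ℍ[ℝ]) : Prop :=
  ∃ J ∈ unitSphere, ∃ p m : Polynomial ℍ[ℝ],
    IsInducedBy P (peirceStem J p m) ∧ IsInducedBy Pv (peirceStem J m p)

/-- The extension of `P` to the real axis, as a function of `(I, α) ∈ 𝕊 × ℝ`:
`P_ℝ (I, α) = lim_{β → 0⁺} P (α + I β)`. -/
def realExt (P : ℍ[ℝ] → ℍ[ℝ]) (I : ℍ[ℝ]) (α : ℝ) : ℍ[ℝ] :=
  Filter.limUnder (nhdsWithin (0 : ℝ) (Set.Ioi 0)) fun β => P (slicePt I ⟨α, β⟩)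

/-! ### Splitting and twistor degree -/

/-- `P` splits on `ℂ_i` through the polynomials `g, h, g', h'`
(`g'` and `h'` stand for `ĝ` and `ĥ`):
`P v = g v + h v j` on `ℂ_i⁺`, `P v = conj (ĝ (conj v)) + conj (ĥ (conj v)) j` on `ℂ_i⁻`. -/
def SplitsAs (P : ℍ[ℝ] → ℍ[ℝ]) (g g' h h' : Polynomial ℂ) : Prop :=
  (∀ v : ℂ, 0 < v.im → P (quat v 0) = quat (g.eval v) (h.eval v)) ∧
  (∀ v : ℂ, v.im < 0 → P (quat v 0) =
    quat (star (g'.eval (star v))) (star (h'.eval (star v))))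

/-- The polynomial `D_q = -(g - q₁)(conj q₁ - ĝ) + (h - q₂)(ĥ - conj q₂)`, with `q = q₁ + q₂ j`. -/
def detPoly (g g' h h' : Polynomial ℂ) (q : ℍ[ℝ]) : Polynomial ℂ :=
  -((g - Polynomial.C (co1 q)) * (Polynomial.C (star (co1 q)) - g')) +
    (h - Polynomial.C (co2 q)) * (h' - Polynomial.C (star (co2 q)))

/-- The twistor degree of a slice-polynomial function: the maximum over `q ∈ ℍ` of `deg D_q`,
formed with the (unique) splitting of `P` on `ℂ_i`. -/
def twistorDegree (P : ℍ[ℝ] → ℍ[ℝ]) : ℕ :=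
  sSup {n | ∃ g g' h h' : Polynomial ℂ, SplitsAs P g g' h h' ∧
    ∃ q : ℍ[ℝ], n = (detPoly g g' h h' q).natDegree}

/-! ### Twistor fibration and the extended twistor lift -/

/-- Complex projective space `ℂℙ³`. -/
abbrev CP3 : Type := Projectivization ℂ (Fin 4 → ℂ)

/-- The part of the Segre quadric `𝒬 = {X₀ X₃ = X₁ X₂} ⊂ ℂℙ³` lying over `ℍ ⊂ ℍℙ¹`, i.e. outside
the line `X₀ = X₁ = 0`, which is the twistor fibre over `∞`. It is the union of
`𝒬⁺`, `𝒬⁻` and of the points over `ℝ`, and it is parameterised by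
`([s,u],v) ∈ ℂℙ¹ × ℂ` through `[s, u, s v, u v]`. -/
def Quadric : Type :=
  {X : CP3 // X.rep 0 * X.rep 3 = X.rep 1 * X.rep 2 ∧ ¬ (X.rep 0 = 0 ∧ X.rep 1 = 0)}

/-- The quaternion `X₀ + X₁ j`. -/
def denom (X : Fin 4 → ℂ) : ℍ[ℝ] := quat (X 0) (X 1)

/-- The twistor projection `[X₀ + X₁ j, X₂ + X₃ j]`, read in `ℍ ⊂ ℍℙ¹` (left projective line,
`q ↦ [1, q]`): `(X₀ + X₁ j)⁻¹ (X₂ + X₃ j)`. -/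
def twistorProj (X : Fin 4 → ℂ) : ℍ[ℝ] := (denom X)⁻¹ * quat (X 2) (X 3)

/-- The condition defining `𝒬⁺` inside `𝒬`. -/
def InPlus (X : Fin 4 → ℂ) : Prop :=
  (X 0 ≠ 0 ∧ 0 < (X 2 / X 0).im) ∨ (X 1 ≠ 0 ∧ 0 < (X 3 / X 1).im)

/-- The condition defining `𝒬⁻` inside `𝒬`. -/
def InMinus (X : Fin 4 → ℂ) : Prop :=
  (X 0 ≠ 0 ∧ (X 2 / X 0).im < 0) ∨ (X 1 ≠ 0 ∧ (X 3 / X 1).im < 0)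

/-- The imaginary unit `I = (s + u j)⁻¹ i (s + u j)` that corresponds to `[s, u] ∈ ℂℙ¹`. -/
def unitOf (X : Fin 4 → ℂ) : ℍ[ℝ] := (denom X)⁻¹ * quat Complex.I 0 * denom X

open Classical in
/-- The quaternion over which the lift of `X` lies: `P (π X)` on `𝒬⁺`, `Pv (π X)` on `𝒬⁻`
(`Pv` being the companion), and `P_ℝ (I, α)` at the point over `α ∈ ℝ` that corresponds to `I`. -/
def liftBase (P Pv : ℍ[ℝ] → ℍ[ℝ]) (X : Fin 4 → ℂ) : ℍ[ℝ] :=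
  if InPlus X then P (twistorProj X)
  else if InMinus X then Pv (twistorProj X)
  else realExt P (unitOf X) (twistorProj X).re

/-- Homogeneous coordinates of the lift of `X`: the point `[X₀, X₁, Y₂, Y₃]` of the twistor fibre
over `q = liftBase P Pv X` that has the same coordinates `[X₀, X₁]` as `X`, that is,
`Y₂ + Y₃ j = (X₀ + X₁ j) q`. -/
def liftVec (P Pv : ℍ[ℝ] → ℍ[ℝ]) (X : Fin 4 → ℂ) : Fin 4 → ℂ :=
  ![X 0, X 1, co1 (denom X * liftBase P Pv X), co2 (denom X * liftBase P Pv X)]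

theorem liftVec_ne_zero (P Pv : ℍ[ℝ] → ℍ[ℝ]) (X : Fin 4 → ℂ) (hX : ¬ (X 0 = 0 ∧ X 1 = 0)) :
    liftVec P Pv X ≠ 0 := by
  intro h
  apply hX
  have h0 := congrFun h 0
  have h1 := congrFun h 1
  simp [liftVec] at h0 h1
  exact ⟨h0, h1⟩

/-- The extended twistor lift `𝒫` of a slice-polynomial function `P` with companion `Pv`. -/
def extendedTwistorLift (P Pv : ℍ[ℝ] → ℍ[ℝ]) (X : Quadric) : CP3 :=
  Projectivization.mk ℂ (liftVec P Pv X.1.rep) (liftVec_ne_zero P Pv X.1.rep X.2.2)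

/-- `f` is generically `k : 1` onto its image: on a non-empty basic Zariski-open subset `{G ≠ 0}`
of the image, each point has exactly `k` preimages. (The images considered are those of an
irreducible variety, so that a non-empty Zariski-open subset of the image is dense in it.) -/
def GenericallyToOne {S : Type} (f : S → CP3) (k : ℕ) : Prop :=
  ∃ (G : MvPolynomial (Fin 4) ℂ) (m : ℕ), G.IsHomogeneous m ∧
    (∃ x, MvPolynomial.eval (f x).rep G ≠ 0) ∧
    ∀ y ∈ Set.range f, MvPolynomial.eval y.rep G ≠ 0 → (f ⁻¹' {y}).encard = k

end

end SlicePoly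

/-! Above the real axis `P`, and below it the companion, are induced by one and the same polynomial
function of `z`. Hence the lift is the polynomial map `[s, u, s g - u ĥ, s h + u ĝ]` on the whole
quadric (`LiftData.liftVec_eq`), and `d` is the largest of the degrees of `g, ĝ, h, ĥ` and `w = g ĝ
+ h ĥ` (`SplitsAs.twistorDegree_eq`). The four coordinates are polynomials in `s, u, v`, so they
satisfy an algebraic relation; a homogeneous one of least degree `n` is an irreducible `F`. To
compare `n` with `d`, project from a point off the surface, moved to `[1, 0, 0, 0]` by a shear. A
line through this point fixes `(u, A, B)`, the last three coordinates. On it the surface has `n`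
points for generic `(u, A, B)`. The parameters over it are the roots `v` of `A h - B g + u w`,
because `s` can be eliminated from `s g - u ĥ = A`, `s h + u ĝ = B`, and recovered from `v` by a
Bézout relation between `g` and `h`. Generically there are `d` such roots, all simple. Each of the
`n` points is hit, by a resultant argument, and is hit `k` times, so `k n = d`
(`mul_eq_of_generic_fibre`). -/

namespace SlicePoly

/-! ### Bézout relations and resultants. -/

open Polynomial in
-- By Gauss's lemma `f` stays irreducible over the fraction field, where it is therefore coprime to
-- `p`; `r` is their resultant. Where `r` does not vanish, specialisations of `f` and `p` have no
-- common root.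
theorem exists_mul_add_mul_eq_C_of_irreducible {R : Type*} [CommRing R] [IsDomain R]
    [UniqueFactorizationMonoid R] {f p : R[X]} (hf : Irreducible f) (hd : f.natDegree ≠ 0)
    (hp : ¬ f ∣ p) : ∃ (a b : R[X]) (r : R), r ≠ 0 ∧ f * a + p * b = C r := by
  let : NormalizedGCDMonoid R := Nonempty.some inferInstance
  let K := FractionRing R
  have hprim : f.IsPrimitive := hf.isPrimitive hd
  have hK : IsCoprime (f.map (algebraMap R K)) (p.map (algebraMap R K)) := by
    rw [((hprim.irreducible_iff_irreducible_map_fraction_map (K := K)).1 hf).coprime_iff_not_dvd]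
    exact fun h => hp (hprim.dvd_of_fraction_map_dvd_fraction_map (K := K) h)
  have hres := resultant_ne_zero _ _ hK
  rw [natDegree_map_eq_of_injective (IsFractionRing.injective R K),
    natDegree_map_eq_of_injective (IsFractionRing.injective R K), resultant_map_map] at hres
  obtain ⟨a, b, -, -, h⟩ := exists_mul_add_mul_eq_C_resultant f p le_rfl le_rfl (Or.inl hd)
  exact ⟨a, b, _, fun h0 => hres (by rw [h0, map_zero]), h⟩

open Polynomial in
-- In characteristic zero the derivative is nonzero and of smaller degree, so `f` cannot divide it.
theorem exists_mul_add_derivative_mul_eq_C {R : Type*} [CommRing R] [IsDomain R]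
    [UniqueFactorizationMonoid R] [CharZero R] {f : R[X]} (hf : Irreducible f)
    (hd : f.natDegree ≠ 0) :
    ∃ (a b : R[X]) (r : R), r ≠ 0 ∧ f * a + derivative f * b = C r := by
  refine exists_mul_add_mul_eq_C_of_irreducible hf hd fun h => ?_
  have h0 : derivative f ≠ 0 := fun h0 => hd (derivative_eq_zero.1 h0)
  exact absurd (natDegree_le_of_dvd h h0) (not_le.2 (natDegree_derivative_lt hd))

open Polynomial in
/-- If a Bézout relation between `f` and its derivative has a right hand side that does not vanish
under `φ`, then the image of `f` has as many roots as its degree says. -/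
theorem card_roots_map_of_mul_add_derivative_mul_eq_C {R K : Type*} [CommRing R] [Field K]
    [IsAlgClosed K] [DecidableEq K] (φ : R →+* K) {f a b : R[X]} {r : R}
    (h : f * a + derivative f * b = C r) (hr : φ r ≠ 0) (hl : φ f.leadingCoeff ≠ 0) :
    (f.map φ).roots.toFinset.card = f.natDegree := by
  have hsep : (f.map φ).Separable := by
    refine ⟨C (φ r)⁻¹ * a.map φ, C (φ r)⁻¹ * b.map φ, ?_⟩
    have h1 := congrArg (Polynomial.map φ) h
    simp only [Polynomial.map_add, Polynomial.map_mul, Polynomial.map_C] at h1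
    rw [derivative_map]
    calc _ = C (φ r)⁻¹ * (f.map φ * a.map φ + (derivative f).map φ * b.map φ) := by ring
      _ = 1 := by rw [h1, ← C_mul, inv_mul_cancel₀ hr, C_1]
  rw [Multiset.toFinset_card_of_nodup (nodup_roots hsep),
    ← natDegree_map_of_leadingCoeff_ne_zero φ hl]
  exact ((IsAlgClosed.splits _).natDegree_eq_card_roots).symm

open Polynomial in
-- The formal degree `n` may exceed the true one, since degrees drop under specialisation. As `f`
-- has its exact degree, this only costs a power of its leading coefficient, up to sign.
theorem exists_common_root_of_resultant_eq_zero {K : Type*} [Field K] [IsAlgClosed K]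
    {f g : K[X]} (hf : f ≠ 0) {n : ℕ} (hn : g.natDegree ≤ n)
    (h : resultant f g f.natDegree n = 0) : ∃ v, f.eval v = 0 ∧ g.eval v = 0 := by
  obtain ⟨k, rfl⟩ := Nat.exists_eq_add_of_le hn
  rw [resultant_add_right_deg _ _ _ _ _ le_rfl, mul_eq_zero] at h
  have h := h.resolve_left (pow_ne_zero _ (leadingCoeff_ne_zero.2 hf))
  have h2 := (resultant_eq_zero_iff.1 h).2
  rw [isCoprime_iff_aeval_ne_zero_of_isAlgClosed K K] at h2
  push Not at h2
  simpa using h2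

open Polynomial in
theorem resultant_eq_zero_of_common_root {R : Type*} [CommRing R]
    {f g : R[X]} {m n : ℕ} (hf : f.natDegree ≤ m) (hg : g.natDegree ≤ n) (hm : m ≠ 0) {v : R}
    (hfv : f.eval v = 0) (hgv : g.eval v = 0) : resultant f g m n = 0 := by
  obtain ⟨a, b, -, -, h⟩ := exists_mul_add_mul_eq_C_resultant f g hf hg (Or.inl hm)
  have := congrArg (Polynomial.eval v) h
  simpa [hfv, hgv] using this.symm

/-! ### Parameters over a line through `[1, 0, 0, 0]`. -/

/-- The polynomial `A h - B g + u w` in `ℂ[u, A, B][v]`, for `g h w : ℂ[v]`. -/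
noncomputable def pencil (g h w : Polynomial ℂ) : Polynomial (MvPolynomial (Fin 3) ℂ) :=
  Polynomial.C (.X 1) * h.map MvPolynomial.C - Polynomial.C (.X 2) * g.map MvPolynomial.C +
    Polynomial.C (.X 0) * w.map MvPolynomial.C

theorem pencil_map (g h w : Polynomial ℂ) (c : Fin 3 → ℂ) :
    (pencil g h w).map (MvPolynomial.eval c) =
      Polynomial.C (c 1) * h - Polynomial.C (c 2) * g + Polynomial.C (c 0) * w := by
  have : (MvPolynomial.eval c).comp MvPolynomial.C = RingHom.id ℂ := by ext; simp
  simp [pencil, Polynomial.map_map, this]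

/-- Over `ℂ[v]` this is a linear form in `u, A, B` whose coefficients `w, h, -g` have no common
factor. The equivalence `e` exchanges the roles of `v` and of `u, A, B`. -/
theorem irreducible_pencil {g h : Polynomial ℂ} (w : Polynomial ℂ) (hgh : IsCoprime g h) :
    Irreducible (pencil g h w) := by
  let c : Fin 3 →₀ Polynomial ℂ := Finsupp.equivFunOnFinite.symm ![w, h, -g]
  have hc : ∀ r, (∀ i, r ∣ c i) → IsUnit r := by
    intro r hr
    exact hgh.isUnit_of_dvd' (by simpa [c] using hr 2) (by simpa [c] using hr 1)
  have h1 : Irreducible (MvPolynomial.sumSMulX c) := by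
    refine MvPolynomial.irreducible_sumSMulX c ?_ hc
    by_contra h0
    rw [Finset.not_nonempty_iff_eq_empty, Finsupp.support_eq_empty] at h0
    have := hc 0 (by simp [h0])
    simp at this
  let e := (MvPolynomial.optionEquivRight ℂ (Fin 3)).symm.trans
    (MvPolynomial.optionEquivLeft ℂ (Fin 3))
  have hC : ∀ p : Polynomial ℂ, e (MvPolynomial.C p) = p.map MvPolynomial.C := by
    intro p
    have : ((e : _ →ₐ[ℂ] _).comp (IsScalarTower.toAlgHom ℂ (Polynomial ℂ)
        (MvPolynomial (Fin 3) (Polynomial ℂ)))) =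
        (Polynomial.mapAlgHom (Algebra.ofId ℂ (MvPolynomial (Fin 3) ℂ))) := by
      ext
      simp [e, MvPolynomial.algebraMap_eq]
    exact DFunLike.congr_fun this p
  have hX : ∀ i, e (MvPolynomial.X i) = Polynomial.C (.X i) := by
    intro i; simp [e]
  have h2 : e (MvPolynomial.sumSMulX c) = pencil g h w := by
    rw [MvPolynomial.sumSMulX, Finsupp.linearCombination_apply, Finsupp.sum_fintype _ _ (by simp),
      Fin.sum_univ_three]
    simp only [map_add, MvPolynomial.smul_eq_C_mul, map_mul, hC, hX]
    simp [c, pencil]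
    ring
  rw [← h2]
  exact (MulEquiv.irreducible_iff e.toMulEquiv).2 h1

/-- Homogeneous coordinates `[s, u, s g(v) - u ĥ(v), s h(v) + u ĝ(v)]` of the lift. -/
noncomputable def liftCoords (g g' h h' : Polynomial ℂ) (s u v : ℂ) : Fin 4 → ℂ :=
  ![s, u, s * g.eval v - u * h'.eval v, s * h.eval v + u * g'.eval v]

theorem exists_eval_ne_zero {σ : Type*} {p : MvPolynomial σ ℂ} (hp : p ≠ 0) :
    ∃ x, MvPolynomial.eval x p ≠ 0 := by
  by_contra! h
  exact hp (MvPolynomial.funext fun x => by simpa using h x)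

/-- The coordinate `s` as a function of `u, A, B, v` on the root locus of `pencil`, where
`p g + q h = 1`. -/
noncomputable def rootCoord (a b p q : Polynomial ℂ) : Polynomial (MvPolynomial (Fin 3) ℂ) :=
  p.map MvPolynomial.C * (Polynomial.C (.X 1) + Polynomial.C (.X 0) * b.map MvPolynomial.C) +
    q.map MvPolynomial.C * (Polynomial.C (.X 2) - Polynomial.C (.X 0) * a.map MvPolynomial.C)

theorem rootCoord_map (a b p q : Polynomial ℂ) (c : Fin 3 → ℂ) :
    (rootCoord a b p q).map (MvPolynomial.eval c) =
      p * (Polynomial.C (c 1) + Polynomial.C (c 0) * b) +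
        q * (Polynomial.C (c 2) - Polynomial.C (c 0) * a) := by
  have : (MvPolynomial.eval c).comp MvPolynomial.C = RingHom.id ℂ := by ext; simp
  simp [rootCoord, Polynomial.map_map, this]

/-- Eliminating `s` from `s g - u ĥ = A` and `s h + u ĝ = B` gives the pencil; combining them with
multipliers `p` and `q` isolates `s`. -/
theorem liftCoords_eq_cons_iff {g g' h h' p q : Polynomial ℂ} (hpq : p * g + q * h = 1)
    (c : Fin 3 → ℂ) (s v : ℂ) :
    liftCoords g g' h h' s (c 0) v = Fin.cons s c ↔
      ((pencil g h (g * g' + h * h')).map (MvPolynomial.eval c)).eval v = 0 ∧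
      ((rootCoord g' h' p q).map (MvPolynomial.eval c)).eval v = s := by
  have hv : p.eval v * g.eval v + q.eval v * h.eval v = 1 := by
    simpa using congrArg (Polynomial.eval v) hpq
  have key : liftCoords g g' h h' s (c 0) v = Fin.cons s c ↔
      s * g.eval v - c 0 * h'.eval v = c 1 ∧ s * h.eval v + c 0 * g'.eval v = c 2 := by
    constructor
    · intro H
      exact ⟨congrFun H 2, congrFun H 3⟩
    · rintro ⟨h1, h2⟩
      funext i
      fin_cases i
      · rfl
      · rfl
      · exact h1
      · exact h2
  rw [key, pencil_map, rootCoord_map]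
  simp only [Polynomial.eval_add, Polynomial.eval_sub, Polynomial.eval_mul, Polynomial.eval_C]
  constructor
  · rintro ⟨h1, h2⟩
    rw [← h1, ← h2]
    exact ⟨by ring, by linear_combination s * hv⟩
  · rintro ⟨h1, h2⟩
    rw [← h2]
    constructor
    · linear_combination (c 1 + c 0 * h'.eval v) * hv - q.eval v * h1
    · linear_combination (c 2 - c 0 * g'.eval v) * hv + p.eval v * h1

theorem _root_.MvPolynomial.IsHomogeneous.eval_smul_eq {σ : Type*} {F : MvPolynomial σ ℂ} {n : ℕ}
    (hF : F.IsHomogeneous n) (t : ℂ) (x : σ → ℂ) :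
    MvPolynomial.eval (t • x) F = t ^ n * MvPolynomial.eval x F := by
  rw [MvPolynomial.eval_eq, MvPolynomial.eval_eq, Finset.mul_sum]
  refine Finset.sum_congr rfl fun d hd => ?_
  have h := hF (MvPolynomial.mem_support_iff.1 hd)
  change Finsupp.weight (fun _ => 1) d = n at h
  rw [← Finsupp.degree_eq_weight_one, Finsupp.degree_apply] at h
  simp only [Pi.smul_apply, smul_eq_mul, mul_pow, Finset.prod_mul_distrib,
    Finset.prod_pow_eq_pow_sum, h]
  ring

open Polynomial in
-- Setting the other variables to zero leaves `F(1, 0, …, 0) xⁿ`, so the top power of the first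
-- variable survives.
theorem natDegree_finSuccEquiv_of_isHomogeneous {m n : ℕ} {F : MvPolynomial (Fin (m + 1)) ℂ}
    (hF : F.IsHomogeneous n) (h0 : MvPolynomial.eval (Fin.cons 1 0) F ≠ 0) :
    (MvPolynomial.finSuccEquiv ℂ m F).natDegree = n := by
  apply le_antisymm
  · rw [MvPolynomial.natDegree_finSuccEquiv]
    exact (MvPolynomial.degreeOf_le_totalDegree F 0).trans hF.totalDegree_le
  · have hmap : (MvPolynomial.finSuccEquiv ℂ m F).map (MvPolynomial.eval 0) =
        Polynomial.C (MvPolynomial.eval (Fin.cons 1 0) F) * X ^ n := by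
      refine Polynomial.funext fun x => ?_
      rw [← MvPolynomial.eval_eq_eval_mv_eval']
      have : (Fin.cons x 0 : Fin (m + 1) → ℂ) = x • Fin.cons 1 0 := by
        funext i
        refine Fin.cases ?_ (fun j => ?_) i
        · rw [Pi.smul_apply, Fin.cons_zero, Fin.cons_zero, smul_eq_mul, mul_one]
        · rw [Pi.smul_apply, Fin.cons_succ, Fin.cons_succ]
          exact (mul_zero x).symm
      rw [this, hF.eval_smul_eq, eval_mul, eval_C, eval_pow, eval_X, mul_comm]
    calc n = ((MvPolynomial.finSuccEquiv ℂ m F).map (MvPolynomial.eval 0)).natDegree := by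
          rw [hmap, natDegree_C_mul_X_pow _ _ h0]
      _ ≤ _ := natDegree_map_le

theorem natDegree_pencil {g h w : Polynomial ℂ} {d : ℕ} (hg : g.natDegree ≤ d)
    (hh : h.natDegree ≤ d) (hw : w.natDegree ≤ d)
    (hd : ¬ (g.coeff d = 0 ∧ h.coeff d = 0 ∧ w.coeff d = 0)) :
    (pencil g h w).natDegree = d := by
  apply le_antisymm
  · have hC : ∀ (r : MvPolynomial (Fin 3) ℂ) (p : Polynomial ℂ), p.natDegree ≤ d →
        (Polynomial.C r * p.map MvPolynomial.C).natDegree ≤ d := fun r p hp =>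
      (Polynomial.natDegree_C_mul_le _ _).trans (Polynomial.natDegree_map_le.trans hp)
    exact Polynomial.natDegree_add_le_of_degree_le
      ((Polynomial.natDegree_sub_le_of_le (hC _ _ hh) (hC _ _ hg)).trans (max_self d).le) (hC _ _ hw)
  · apply Polynomial.le_natDegree_of_ne_zero
    intro h0
    have h1 : ∀ c : Fin 3 → ℂ, c 1 * h.coeff d - c 2 * g.coeff d + c 0 * w.coeff d = 0 := by
      intro c
      have := congrArg (MvPolynomial.eval c) h0
      simpa [pencil] using this
    have hu := h1 ![1, 0, 0]
    have hA := h1 ![0, 1, 0]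
    have hB := h1 ![0, 0, 1]
    simp at hu hA hB
    exact hd ⟨hB, hA, hu⟩

/-! ### The degree count. -/

open Polynomial in
/-- The degree count for the surface `F = 0` swept out by `liftCoords`, when the point
`[1, 0, 0, 0]`, which serves as a centre of projection, is not on the surface. -/
theorem mul_eq_of_generic_fibre {g g' h h' : ℂ[X]} {d n k : ℕ} {F G : MvPolynomial (Fin 4) ℂ}
    (hd0 : d ≠ 0) (hg : g.natDegree ≤ d) (hh : h.natDegree ≤ d)
    (hw : (g * g' + h * h').natDegree ≤ d)
    (hd : ¬ (g.coeff d = 0 ∧ h.coeff d = 0 ∧ (g * g' + h * h').coeff d = 0))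
    (hFi : Irreducible F) (hFh : F.IsHomogeneous n) (hF0 : MvPolynomial.eval (Fin.cons 1 0) F ≠ 0)
    (hFv : ∀ s u v, MvPolynomial.eval (liftCoords g g' h h' s u v) F = 0)
    (hG : ∃ s u v, MvPolynomial.eval (liftCoords g g' h h' s u v) G ≠ 0)
    (hk : ∀ s u v, u ≠ 0 → MvPolynomial.eval (liftCoords g g' h h' s u v) G ≠ 0 →
      {v' | liftCoords g g' h h' s u v' = liftCoords g g' h h' s u v}.encard = k) :
    k * n = d := by
  classical
  -- At a common root of `g` and `h` the parameters `s = 1`, `u = 0` would give the centre `[1, 0,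
  -- 0, 0]`, which is off the surface.
  have hgh : IsCoprime g h := by
    rw [isCoprime_iff_aeval_ne_zero_of_isAlgClosed ℂ ℂ]
    intro v
    by_contra! H
    apply hF0
    have h1 : g.eval v = 0 := by simpa using H.1
    have h2 : h.eval v = 0 := by simpa using H.2
    have h3 : (Fin.cons 1 0 : Fin 4 → ℂ) = liftCoords g g' h h' 1 0 v := by
      funext i
      fin_cases i <;> simp [liftCoords, h1, h2] <;> rfl
    rw [h3, hFv]
  obtain ⟨p, q, hpq⟩ := hgh
  set E := pencil g h (g * g' + h * h') with hE
  set S := rootCoord g' h' p q with hS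
  have hEi : Irreducible E := irreducible_pencil _ ⟨p, q, hpq⟩
  have hEd : E.natDegree = d := natDegree_pencil hg hh hw hd
  have hEl : E.leadingCoeff ≠ 0 := leadingCoeff_ne_zero.2 hEi.ne_zero
  set f := MvPolynomial.finSuccEquiv ℂ 3 F with hf
  have hfi : Irreducible f :=
    (MulEquiv.irreducible_iff (MvPolynomial.finSuccEquiv ℂ 3).toMulEquiv).2 hFi
  have hfd : f.natDegree = n := natDegree_finSuccEquiv_of_isHomogeneous hFh hF0
  have hn0 : n ≠ 0 := by
    rintro rfl
    have hC := MvPolynomial.totalDegree_eq_zero_iff_eq_C.1 (Nat.le_zero.1 hFh.totalDegree_le)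
    apply hF0
    have := hFv 0 0 0
    rw [hC, MvPolynomial.eval_C] at this ⊢
    exact this
  have hfl : f.leadingCoeff ≠ 0 := leadingCoeff_ne_zero.2 hfi.ne_zero
  have hfev : ∀ x c, (f.map (MvPolynomial.eval c)).eval x = MvPolynomial.eval (Fin.cons x c) F :=
    fun x c => (MvPolynomial.eval_eq_eval_mv_eval' c x F).symm
  -- the resultant `N` of the pencil and of `X - S` vanishes on the surface
  set E₁ : (MvPolynomial (Fin 3) ℂ)[X][X] := E.map C with hE₁
  set S₁ : (MvPolynomial (Fin 3) ℂ)[X][X] := C X - S.map C with hS₁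
  set N := resultant E₁ S₁ d S₁.natDegree with hN
  let ev (c : Fin 3 → ℂ) (x : ℂ) : (MvPolynomial (Fin 3) ℂ)[X] →+* ℂ :=
    (evalRingHom x).comp (mapRingHom (MvPolynomial.eval c))
  have hevC : ∀ c x, (ev c x).comp C = MvPolynomial.eval c := by
    intro c x; ext <;> simp [ev]
  have hevX : ∀ c x, ev c x X = x := by
    intro c x; simp [ev]
  have hNev : ∀ c x, (N.map (MvPolynomial.eval c)).eval x =
      resultant (E.map (MvPolynomial.eval c)) (C x - S.map (MvPolynomial.eval c)) d
        S₁.natDegree := by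
    intro c x
    have h1 : (N.map (MvPolynomial.eval c)).eval x = ev c x N := rfl
    rw [h1, hN, ← resultant_map_map, hE₁, hS₁, Polynomial.map_sub, Polynomial.map_map,
      Polynomial.map_map, hevC, map_C, hevX]
  have hSd : ∀ c x, (C x - S.map (MvPolynomial.eval c)).natDegree ≤ S₁.natDegree := by
    intro c x
    have : C x - S.map (MvPolynomial.eval c) = S₁.map (ev c x) := by
      rw [hS₁, Polynomial.map_sub, Polynomial.map_map, hevC, map_C, hevX]
    rw [this]
    exact natDegree_map_le
  have hEc : ∀ c, MvPolynomial.eval c E.leadingCoeff ≠ 0 →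
      (E.map (MvPolynomial.eval c)).natDegree = d := fun c hc => by
    rw [natDegree_map_of_leadingCoeff_ne_zero _ hc, hEd]
  -- Otherwise `f` and `N` have no common root over a generic `c`. But any root `v` of the
  -- specialised pencil gives one, namely `x = S(v)`.
  have hfN : f ∣ N := by
    by_contra hndvd
    obtain ⟨a, b, r, hr, hab⟩ :=
      exists_mul_add_mul_eq_C_of_irreducible hfi (by rwa [hfd]) hndvd
    obtain ⟨c, hc⟩ := exists_eval_ne_zero (mul_ne_zero hEl hr)
    rw [map_mul] at hc
    have hlc := left_ne_zero_of_mul hc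
    obtain ⟨v, hv⟩ := IsAlgClosed.exists_root (E.map (MvPolynomial.eval c)) (by
      intro h0
      exact hd0 ((hEc c hlc).symm.trans (natDegree_eq_of_degree_eq_some h0)))
    set x := (S.map (MvPolynomial.eval c)).eval v with hx
    have h1 := (liftCoords_eq_cons_iff (g' := g') (h' := h') hpq c x v).2 ⟨hv, rfl⟩
    have h2 : (N.map (MvPolynomial.eval c)).eval x = 0 := by
      rw [hNev]
      exact resultant_eq_zero_of_common_root (hEc c hlc).le (hSd c x) hd0 hv (by simp [hx])
    have h3 : (f.map (MvPolynomial.eval c)).eval x = 0 := by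
      rw [hfev, ← h1]; exact hFv _ _ _
    have h4 := congrArg (fun t => (t.map (MvPolynomial.eval c)).eval x) hab
    simp only [Polynomial.map_add, Polynomial.map_mul, eval_add, eval_mul, h2, h3, map_C,
      eval_C] at h4
    apply right_ne_zero_of_mul hc
    rw [← h4]; ring
  -- `F` vanishes on the whole image, `G` does not.
  have hfG : ¬ f ∣ MvPolynomial.finSuccEquiv ℂ 3 G := by
    rw [hf, map_dvd_iff]
    rintro ⟨Q, rfl⟩
    obtain ⟨s, u, v, H⟩ := hG
    exact H (by rw [map_mul, hFv, zero_mul])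
  obtain ⟨a₁, b₁, r₁, hr₁, hab₁⟩ := exists_mul_add_derivative_mul_eq_C hEi (by rwa [hEd])
  obtain ⟨a₂, b₂, r₂, hr₂, hab₂⟩ := exists_mul_add_derivative_mul_eq_C hfi (by rwa [hfd])
  obtain ⟨a₃, b₃, r₃, hr₃, hab₃⟩ :=
    exists_mul_add_mul_eq_C_of_irreducible hfi (by rwa [hfd]) hfG
  -- A generic line: `r₁`, `r₂` make the roots of `E` and `f` simple, the leading coefficients keep
  -- their degrees, `r₃` keeps `G` nonzero at the points of the surface on this line, and `X 0`
  -- ensures `u ≠ 0`, as `hk` demands.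
  obtain ⟨c, hc⟩ := exists_eval_ne_zero (mul_ne_zero (mul_ne_zero (mul_ne_zero hr₁ hr₂)
    (mul_ne_zero hEl hfl)) (mul_ne_zero hr₃ (MvPolynomial.X_ne_zero (R := ℂ) (0 : Fin 3))))
  simp only [map_mul, mul_ne_zero_iff, MvPolynomial.eval_X] at hc
  obtain ⟨⟨⟨hc₁, hc₂⟩, hcE, hcf⟩, hc₃, hc0⟩ := hc
  have hV := card_roots_map_of_mul_add_derivative_mul_eq_C _ hab₁ hc₁ hcE
  have hW := card_roots_map_of_mul_add_derivative_mul_eq_C _ hab₂ hc₂ hcf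
  have hE0 : E.map (MvPolynomial.eval c) ≠ 0 := fun h0 => hd0 (by rw [← hEc c hcE, h0]; simp)
  have hf0 : f.map (MvPolynomial.eval c) ≠ 0 := fun h0 => hn0 (by
    rw [← hfd, ← natDegree_map_of_leadingCoeff_ne_zero _ hcf, h0]; simp)
  rw [hEd] at hV
  rw [hfd] at hW
  have hmaps : Set.MapsTo (fun v => (S.map (MvPolynomial.eval c)).eval v)
      ((E.map (MvPolynomial.eval c)).roots.toFinset : Set ℂ)
      ((f.map (MvPolynomial.eval c)).roots.toFinset : Set ℂ) := by
    intro v hv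
    simp only [Finset.mem_coe, Multiset.mem_toFinset, mem_roots hE0, IsRoot.def] at hv
    simp only [Finset.mem_coe, Multiset.mem_toFinset, mem_roots hf0, IsRoot.def]
    rw [hfev, ← (liftCoords_eq_cons_iff (g' := g') (h' := h') hpq c _ v).2 ⟨hv, rfl⟩]
    exact hFv _ _ _
  -- Count the `d` roots of `E` according to their images among the `n` roots of `f`; it remains to
  -- see that each fibre has `k` elements.
  rw [← hV, Finset.card_eq_sum_card_fiberwise hmaps, Finset.sum_const_nat (m := k), hW, mul_comm]
  intro x hx
  simp only [Multiset.mem_toFinset, mem_roots hf0, IsRoot.def] at hx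
  -- Since `f ∣ N`, every root `x` of `f` makes the resultant vanish, so `x = S(v)` for some root
  -- `v` of `E`: the point is in the image and `hk` applies to it.
  have hNx : (N.map (MvPolynomial.eval c)).eval x = 0 := by
    obtain ⟨M, hM⟩ := hfN
    rw [hM, Polynomial.map_mul, eval_mul, hx, zero_mul]
  rw [hNev, ← hEc c hcE] at hNx
  obtain ⟨v, hv, hvS⟩ := exists_common_root_of_resultant_eq_zero hE0 (hSd c x) hNx
  have hvS : (S.map (MvPolynomial.eval c)).eval v = x := by
    rw [eval_sub, eval_C, sub_eq_zero] at hvS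
    exact hvS.symm
  have hvx := (liftCoords_eq_cons_iff (g' := g') (h' := h') hpq c x v).2 ⟨hv, hvS⟩
  have hGx : MvPolynomial.eval (Fin.cons x c : Fin 4 → ℂ) G ≠ 0 := by
    intro h0
    rw [MvPolynomial.eval_eq_eval_mv_eval'] at h0
    apply hc₃
    have h4 := congrArg (fun t => (t.map (MvPolynomial.eval c)).eval x) hab₃
    simp only [Polynomial.map_add, Polynomial.map_mul, eval_add, eval_mul, hx, h0, map_C,
      eval_C] at h4
    rw [← h4]; ring
  have hcard := hk x (c 0) v hc0 (by rwa [hvx])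
  rw [hvx] at hcard
  have hset : {v' | liftCoords g g' h h' x (c 0) v' = Fin.cons x c} =
      (((E.map (MvPolynomial.eval c)).roots.toFinset.filter
        fun v => (S.map (MvPolynomial.eval c)).eval v = x : Finset ℂ) : Set ℂ) := by
    ext v'
    rw [Set.mem_ofPred_eq, liftCoords_eq_cons_iff hpq c x v', ← hE, ← hS]
    simp [hE0]
  rw [hset, Set.encard_coe_eq_coe_finsetCard] at hcard
  exact_mod_cast hcard

/-! ### An irreducible homogeneous equation of the image. -/

theorem liftCoords_smul (g g' h h' : Polynomial ℂ) (t s u v : ℂ) :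
    liftCoords g g' h h' (t * s) (t * u) v = t • liftCoords g g' h h' s u v := by
  funext i
  fin_cases i <;> simp [liftCoords] <;> ring

theorem liftCoords_eq_liftCoords_iff (g g' h h' : Polynomial ℂ) (s u v v' : ℂ) :
    liftCoords g g' h h' s u v' = liftCoords g g' h h' s u v ↔
      s * g.eval v' - u * h'.eval v' = s * g.eval v - u * h'.eval v ∧
      s * h.eval v' + u * g'.eval v' = s * h.eval v + u * g'.eval v := by
  simp [liftCoords]

/-- The homomorphism of coordinate rings given by `liftCoords`. -/
noncomputable def liftHom (g g' h h' : Polynomial ℂ) :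
    MvPolynomial (Fin 4) ℂ →ₐ[ℂ] MvPolynomial (Fin 3) ℂ :=
  MvPolynomial.aeval ![.X 0, .X 1,
    .X 0 * Polynomial.aeval (.X 2) g - .X 1 * Polynomial.aeval (.X 2) h',
    .X 0 * Polynomial.aeval (.X 2) h + .X 1 * Polynomial.aeval (.X 2) g']

theorem eval_polynomial_aeval_X (p : Polynomial ℂ) (x : Fin 3 → ℂ) :
    MvPolynomial.eval x (Polynomial.aeval (.X 2 : MvPolynomial (Fin 3) ℂ) p) = p.eval (x 2) := by
  have := Polynomial.aeval_algHom_apply (MvPolynomial.aeval x : MvPolynomial (Fin 3) ℂ →ₐ[ℂ] ℂ)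
    (MvPolynomial.X 2) p
  rw [MvPolynomial.aeval_X, Polynomial.coe_aeval_eq_eval] at this
  rw [this, MvPolynomial.aeval_eq_eval]

theorem eval_liftHom (g g' h h' : Polynomial ℂ) (F : MvPolynomial (Fin 4) ℂ) (x : Fin 3 → ℂ) :
    MvPolynomial.eval x (liftHom g g' h h' F) =
      MvPolynomial.eval (liftCoords g g' h h' (x 0) (x 1) (x 2)) F := by
  have : (MvPolynomial.aeval x : MvPolynomial (Fin 3) ℂ →ₐ[ℂ] ℂ).comp (liftHom g g' h h') =
      MvPolynomial.aeval (liftCoords g g' h h' (x 0) (x 1) (x 2)) := by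
    apply MvPolynomial.algHom_ext
    intro i
    fin_cases i <;>
      simp [liftHom, liftCoords, MvPolynomial.aeval_eq_eval, eval_polynomial_aeval_X]
  have := DFunLike.congr_fun this F
  simpa [MvPolynomial.aeval_eq_eval] using this

theorem liftHom_eq_zero_iff {g g' h h' : Polynomial ℂ} {F : MvPolynomial (Fin 4) ℂ} :
    liftHom g g' h h' F = 0 ↔
      ∀ s u v, MvPolynomial.eval (liftCoords g g' h h' s u v) F = 0 := by
  constructor
  · intro H s u v
    have := eval_liftHom g g' h h' F ![s, u, v]
    rw [H] at this
    simpa using this.symm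
  · intro H
    refine MvPolynomial.funext fun x => ?_
    rw [eval_liftHom, H, map_zero]

/-- Four elements of a polynomial ring in three variables are algebraically dependent. -/
theorem exists_liftHom_eq_zero (g g' h h' : Polynomial ℂ) :
    ∃ F, F ≠ 0 ∧ liftHom g g' h h' F = 0 := by
  by_contra! H
  have hinj : Function.Injective (liftHom g g' h h') :=
    (injective_iff_map_eq_zero _).2 fun F hF => by
      by_contra h0
      exact H F h0 hF
  have hind : AlgebraicIndependent ℂ _ := hinj
  have := hind.lift_cardinalMk_le_trdeg
  rw [MvPolynomial.trdeg_of_isDomain] at this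
  simp at this
  norm_cast at this

/-- The image is a cone: scaling `(s, u)` by `t` scales the point by `t`. The values of the
homogeneous components are thus the coefficients of a polynomial in `t` that vanishes identically.
-/
theorem liftHom_homogeneousComponent {g g' h h' : Polynomial ℂ} {F : MvPolynomial (Fin 4) ℂ}
    (hF : liftHom g g' h h' F = 0) (i : ℕ) :
    liftHom g g' h h' (MvPolynomial.homogeneousComponent i F) = 0 := by
  rw [liftHom_eq_zero_iff] at hF ⊢
  intro s u v
  by_cases hi : F.totalDegree < i
  · rw [MvPolynomial.homogeneousComponent_eq_zero _ _ hi, map_zero]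
  set x := liftCoords g g' h h' s u v with hx
  let p : Polynomial ℂ := ∑ j ∈ Finset.range (F.totalDegree + 1),
    Polynomial.monomial j (MvPolynomial.eval x (MvPolynomial.homogeneousComponent j F))
  have hp : p = 0 := by
    refine Polynomial.funext fun t => ?_
    have h1 : MvPolynomial.eval (t • x) F = 0 := by rw [hx, ← liftCoords_smul, hF]
    rw [← MvPolynomial.sum_homogeneousComponent F, map_sum] at h1
    rw [Polynomial.eval_finsetSum, Polynomial.eval_zero, ← h1]
    refine Finset.sum_congr rfl fun j _ => ?_
    rw [(MvPolynomial.homogeneousComponent_isHomogeneous j F).eval_smul_eq,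
      Polynomial.eval_monomial, mul_comm]
  have h2 := congrArg (fun q => q.coeff i) hp
  simp only [p, Polynomial.finsetSum_coeff, Polynomial.coeff_monomial, Finset.sum_ite_eq',
    Finset.mem_range, Polynomial.coeff_zero] at h2
  rwa [if_pos (by omega)] at h2

/-- The image of `liftCoords` lies on an irreducible surface. -/
theorem exists_irreducible_isHomogeneous_liftHom_eq_zero (g g' h h' : Polynomial ℂ) :
    ∃ (n : ℕ) (F : MvPolynomial (Fin 4) ℂ), F.IsHomogeneous n ∧ Irreducible F ∧
      liftHom g g' h h' F = 0 := by
  classical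
  have hex : ∃ n F, F ≠ 0 ∧ liftHom g g' h h' F = 0 ∧ F.totalDegree ≤ n := by
    obtain ⟨F, h1, h2⟩ := exists_liftHom_eq_zero g g' h h'
    exact ⟨_, F, h1, h2, le_rfl⟩
  obtain ⟨F₀, h0, hF₀, hdeg⟩ := Nat.find_spec hex
  have hmin : ∀ F, F ≠ 0 → liftHom g g' h h' F = 0 → Nat.find hex ≤ F.totalDegree :=
    fun F h1 h2 => Nat.find_min' hex ⟨F, h1, h2, le_rfl⟩
  obtain ⟨i, hi⟩ : ∃ i, MvPolynomial.homogeneousComponent i F₀ ≠ 0 := by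
    by_contra! H
    exact h0 (by rw [← MvPolynomial.sum_homogeneousComponent F₀]; simp [H])
  have hhom := MvPolynomial.homogeneousComponent_isHomogeneous i F₀
  have hker := liftHom_homogeneousComponent hF₀ i
  have hile : i ≤ F₀.totalDegree := by
    by_contra! H
    exact hi (MvPolynomial.homogeneousComponent_eq_zero _ _ H)
  generalize MvPolynomial.homogeneousComponent i F₀ = F at hi hhom hker
  have hFdeg : F.totalDegree = i := hhom.totalDegree hi
  refine ⟨i, F, hhom, ⟨?_, ?_⟩, hker⟩
  · intro hu
    have := hu.map (liftHom g g' h h')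
    rw [hker] at this
    exact not_isUnit_zero this
  -- The kernel is prime, so one factor of `F` lies in it; by minimality it carries the whole
  -- degree, and the other factor is constant.
  · have key : ∀ a b, F = a * b → liftHom g g' h h' a = 0 → IsUnit b := by
      rintro a b rfl ha
      have ha0 := left_ne_zero_of_mul hi
      have hb0 := right_ne_zero_of_mul hi
      have h1 := hmin a ha0 ha
      rw [MvPolynomial.totalDegree_mul_of_isDomain ha0 hb0] at hFdeg
      have h2 : b.totalDegree = 0 := by omega
      rw [MvPolynomial.totalDegree_eq_zero_iff_eq_C] at h2
      rw [h2] at hb0 ⊢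
      exact (isUnit_iff_ne_zero.2 fun h3 => hb0 (by rw [h3, map_zero])).map MvPolynomial.C
    intro a b hab
    have h1 := hker
    rw [hab, map_mul, mul_eq_zero] at h1
    rcases h1 with h1 | h1
    · exact Or.inr (key a b hab h1)
    · exact Or.inl (key b a (by rw [hab, mul_comm]) h1)

/-! ### Moving the centre of projection. -/

/-- The change of coordinates `X₂ ↦ X₂ + a X₀`, `X₃ ↦ X₃ + b X₀`. -/
noncomputable def shear (a b : ℂ) : MvPolynomial (Fin 4) ℂ →ₐ[ℂ] MvPolynomial (Fin 4) ℂ :=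
  MvPolynomial.aeval ![.X 0, .X 1, .X 2 + .C a * .X 0, .X 3 + .C b * .X 0]

theorem shear_comp_shear_neg (a b : ℂ) : (shear a b).comp (shear (-a) (-b)) = AlgHom.id ℂ _ := by
  apply MvPolynomial.algHom_ext
  intro i
  fin_cases i <;> simp [shear, MvPolynomial.algebraMap_eq]

/-- `shear` as an automorphism. -/
noncomputable def shearEquiv (a b : ℂ) : MvPolynomial (Fin 4) ℂ ≃ₐ[ℂ] MvPolynomial (Fin 4) ℂ :=
  AlgEquiv.ofAlgHom (shear a b) (shear (-a) (-b)) (shear_comp_shear_neg a b)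
    (by simpa using shear_comp_shear_neg (-a) (-b))

theorem eval_shear (a b : ℂ) (x : Fin 4 → ℂ) (F : MvPolynomial (Fin 4) ℂ) :
    MvPolynomial.eval x (shear a b F) =
      MvPolynomial.eval ![x 0, x 1, x 2 + a * x 0, x 3 + b * x 0] F := by
  have : (MvPolynomial.aeval x : MvPolynomial (Fin 4) ℂ →ₐ[ℂ] ℂ).comp (shear a b) =
      MvPolynomial.aeval ![x 0, x 1, x 2 + a * x 0, x 3 + b * x 0] := by
    apply MvPolynomial.algHom_ext
    intro i
    fin_cases i <;> simp [shear]
  have := DFunLike.congr_fun this F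
  simpa [MvPolynomial.aeval_eq_eval] using this

theorem isHomogeneous_shear (a b : ℂ) {F : MvPolynomial (Fin 4) ℂ} {n : ℕ}
    (hF : F.IsHomogeneous n) : (shear a b F).IsHomogeneous n := by
  rw [← one_mul n]
  refine hF.aeval _ fun i => ?_
  have hX := fun j : Fin 4 => MvPolynomial.isHomogeneous_X ℂ j
  fin_cases i
  · exact hX 0
  · exact hX 1
  · exact (hX 2).add (by simpa using (MvPolynomial.isHomogeneous_C _ a).mul (hX 0))
  · exact (hX 3).add (by simpa using (MvPolynomial.isHomogeneous_C _ b).mul (hX 0))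

theorem eval_liftCoords_shear (g g' h h' : Polynomial ℂ) (a b s u v : ℂ)
    (F : MvPolynomial (Fin 4) ℂ) :
    MvPolynomial.eval
      (liftCoords (g - Polynomial.C a) g' (h - Polynomial.C b) h' s u v) (shear a b F) =
      MvPolynomial.eval (liftCoords g g' h h' s u v) F := by
  rw [eval_shear]
  congr 2
  funext i
  fin_cases i <;> simp [liftCoords] <;> ring

/-- By homogeneity `F` vanishes wherever `X₁ = 0` and `X₀ ≠ 0`, hence on the plane `X₁ = 0`; and `F`
is congruent modulo `X₁` to its restriction `e F`. -/
theorem X_dvd_of_eval_eq_zero {F : MvPolynomial (Fin 4) ℂ} {n : ℕ} (hF : F.IsHomogeneous n)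
    (h : ∀ a b, MvPolynomial.eval ![1, 0, a, b] F = 0) : MvPolynomial.X 1 ∣ F := by
  let e : MvPolynomial (Fin 4) ℂ →ₐ[ℂ] MvPolynomial (Fin 4) ℂ :=
    MvPolynomial.aeval ![.X 0, 0, .X 2, .X 3]
  have heval : ∀ x : Fin 4 → ℂ, MvPolynomial.eval x (e F) =
      MvPolynomial.eval ![x 0, 0, x 2, x 3] F := by
    intro x
    have : (MvPolynomial.aeval x : MvPolynomial (Fin 4) ℂ →ₐ[ℂ] ℂ).comp e =
        MvPolynomial.aeval ![x 0, 0, x 2, x 3] := by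
      apply MvPolynomial.algHom_ext
      intro i
      fin_cases i <;> simp [e]
    have := DFunLike.congr_fun this F
    simpa [MvPolynomial.aeval_eq_eval] using this
  have h0 : MvPolynomial.X 0 * e F = 0 := by
    refine MvPolynomial.funext fun x => ?_
    rw [map_mul, heval, MvPolynomial.eval_X, map_zero]
    by_cases hx : x 0 = 0
    · rw [hx, zero_mul]
    have : ![x 0, 0, x 2, x 3] = x 0 • ![1, 0, x 2 / x 0, x 3 / x 0] := by
      funext i
      fin_cases i <;> simp <;> field_simp
    rw [this, hF.eval_smul_eq, h]
    ring
  have he : e F = 0 := (mul_eq_zero.1 h0).resolve_left (MvPolynomial.X_ne_zero _)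
  have hmk : (Ideal.Quotient.mkₐ ℂ (Ideal.span {(MvPolynomial.X 1 : MvPolynomial (Fin 4) ℂ)})).comp
      e = Ideal.Quotient.mkₐ ℂ _ := by
    apply MvPolynomial.algHom_ext
    intro i
    fin_cases i
    · simp [e]
    · simpa [e] using (Ideal.Quotient.eq_zero_iff_mem.2
        (Ideal.mem_span_singleton_self (MvPolynomial.X 1 : MvPolynomial (Fin 4) ℂ))).symm
    · simp [e]
    · simp [e]
  have h3 := DFunLike.congr_fun hmk F
  rw [AlgHom.comp_apply, he, map_zero] at h3
  exact Ideal.mem_span_singleton.1 (Ideal.Quotient.eq_zero_iff_mem.1 h3.symm)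

open Polynomial in
/-- The surface swept out by `liftCoords`, and its degree. -/
theorem exists_surface_of_generic_fibre {g g' h h' : ℂ[X]} {d k : ℕ} {G : MvPolynomial (Fin 4) ℂ}
    (hd0 : d ≠ 0) (hg : g.natDegree ≤ d) (hg' : g'.natDegree ≤ d) (hh : h.natDegree ≤ d)
    (hh' : h'.natDegree ≤ d) (hw : (g * g' + h * h').natDegree ≤ d)
    (hd : ¬ (g.coeff d = 0 ∧ g'.coeff d = 0 ∧ h.coeff d = 0 ∧ h'.coeff d = 0 ∧
      (g * g' + h * h').coeff d = 0))
    (hG : ∃ s u v, MvPolynomial.eval (liftCoords g g' h h' s u v) G ≠ 0)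
    (hk : ∀ s u v, u ≠ 0 → MvPolynomial.eval (liftCoords g g' h h' s u v) G ≠ 0 →
      {v' | liftCoords g g' h h' s u v' = liftCoords g g' h h' s u v}.encard = k) :
    ∃ (n : ℕ) (F : MvPolynomial (Fin 4) ℂ), k * n = d ∧ F.IsHomogeneous n ∧ Irreducible F ∧
      ∀ s u v, MvPolynomial.eval (liftCoords g g' h h' s u v) F = 0 := by
  classical
  obtain ⟨n, F, hFh, hFi, hF⟩ := exists_irreducible_isHomogeneous_liftHom_eq_zero g g' h h'
  rw [liftHom_eq_zero_iff] at hF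
  refine ⟨n, F, ?_, hFh, hFi, hF⟩
  -- choose the centre of projection `[1, 0, a, b]`
  let P : MvPolynomial (Fin 2) ℂ :=
    MvPolynomial.aeval (![1, 0, .X 0, .X 1] : Fin 4 → MvPolynomial (Fin 2) ℂ) F
  have hPeval : ∀ x, MvPolynomial.eval x P = MvPolynomial.eval ![1, 0, x 0, x 1] F := by
    intro x
    have : (MvPolynomial.aeval x : MvPolynomial (Fin 2) ℂ →ₐ[ℂ] ℂ).comp
        (MvPolynomial.aeval (![1, 0, .X 0, .X 1] : Fin 4 → MvPolynomial (Fin 2) ℂ)) =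
        MvPolynomial.aeval ![1, 0, x 0, x 1] := by
      apply MvPolynomial.algHom_ext
      intro i
      fin_cases i <;> simp
    have := DFunLike.congr_fun this F
    simpa [MvPolynomial.aeval_eq_eval, P] using this
  -- If every `[1, 0, a, b]` were on the surface, the surface would be the plane `X₁ = 0`, which
  -- misses the image of `(s, u, v) = (0, 1, 0)`.
  have hP : P ≠ 0 := by
    intro h0
    obtain ⟨Q, rfl⟩ := X_dvd_of_eval_eq_zero hFh fun a b => by
      have := hPeval ![a, b]
      rw [h0] at this
      simpa using this.symm
    rcases hFi.isUnit_or_isUnit rfl with hu | hu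
    · simpa using hu.map (MvPolynomial.eval (0 : Fin 4 → ℂ))
    · have h1 := hF 0 1 0
      rw [map_mul, MvPolynomial.eval_X] at h1
      have h2 := (hu.map (MvPolynomial.eval (liftCoords g g' h h' 0 1 0))).ne_zero
      simp [liftCoords] at h1 h2
      exact h2 h1
  -- The shear replaces `w` by `w - a ĝ - b ĥ` and changes `g, h` by constants. `Q ≠ 0` keeps degree
  -- `d` attained by one of the three polynomials in the new pencil.
  let Q : MvPolynomial (Fin 2) ℂ := if g.coeff d = 0 ∧ h.coeff d = 0 then
    .C ((g * g' + h * h').coeff d) - .C (g'.coeff d) * .X 0 - .C (h'.coeff d) * .X 1 else 1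
  have hQ : Q ≠ 0 := by
    intro h0
    by_cases hc : g.coeff d = 0 ∧ h.coeff d = 0
    · have h1 : ∀ a b : ℂ, (g * g' + h * h').coeff d - g'.coeff d * a - h'.coeff d * b = 0 := by
        intro a b
        have := congrArg (MvPolynomial.eval ![a, b]) h0
        simpa only [Q, if_pos hc, map_sub, map_mul, MvPolynomial.eval_C, MvPolynomial.eval_X,
          map_zero, Matrix.cons_val_zero, Matrix.cons_val_one] using this
      have h2 := h1 0 0
      have h3 := h1 1 0
      have h4 := h1 0 1
      simp only [mul_zero, sub_zero, mul_one] at h2 h3 h4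
      rw [h2, zero_sub, neg_eq_zero] at h3 h4
      exact hd ⟨hc.1, h3, hc.2, h4, h2⟩
    · simp [Q, hc] at h0
  obtain ⟨x, hx⟩ := exists_eval_ne_zero (mul_ne_zero hP hQ)
  rw [map_mul, mul_ne_zero_iff, hPeval] at hx
  obtain ⟨hxP, hxQ⟩ := hx
  have hw1 : (g - C (x 0)) * g' + (h - C (x 1)) * h' =
      g * g' + h * h' - C (x 0) * g' - C (x 1) * h' := by ring
  have hcoeff : ∀ (p : ℂ[X]) (a : ℂ), (p - C a).coeff d = p.coeff d := by
    intro p a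
    rw [coeff_sub, coeff_C_of_ne_zero hd0, sub_zero]
  refine mul_eq_of_generic_fibre (g := g - C (x 0)) (g' := g') (h := h - C (x 1)) (h' := h')
    (F := shear (x 0) (x 1) F) (G := shear (x 0) (x 1) G) hd0 ?_ ?_ ?_ ?_ ?_
    (isHomogeneous_shear _ _ hFh) ?_ ?_ ?_ ?_
  · rwa [natDegree_sub_C]
  · rwa [natDegree_sub_C]
  · rw [hw1]
    exact (natDegree_sub_le_of_le (natDegree_sub_le_of_le hw
      ((natDegree_C_mul_le _ _).trans hg')) ((natDegree_C_mul_le _ _).trans hh')).trans (by simp)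
  · rw [hcoeff, hcoeff, hw1]
    rintro ⟨h1, h2, h3⟩
    apply hxQ
    simp only [Q, if_pos (And.intro h1 h2), map_sub, map_mul, MvPolynomial.eval_C,
      MvPolynomial.eval_X]
    rw [← h3]
    simp only [coeff_sub, coeff_C_mul]
    ring
  · exact (MulEquiv.irreducible_iff (shearEquiv (x 0) (x 1)).toMulEquiv).2 hFi
  · rw [eval_shear]
    convert hxP using 3
    funext i
    fin_cases i <;> simp [Fin.cons] <;> rfl
  · intro s u v
    rw [eval_liftCoords_shear, hF]
  · obtain ⟨s, u, v, H⟩ := hG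
    exact ⟨s, u, v, by rwa [eval_liftCoords_shear]⟩
  · intro s u v hu H
    rw [eval_liftCoords_shear] at H
    rw [← hk s u v hu H]
    congr 1
    ext v'
    simp only [Set.mem_ofPred_eq, liftCoords_eq_liftCoords_iff, eval_sub, eval_C]
    constructor <;> rintro ⟨h1, h2⟩ <;>
      exact ⟨by linear_combination h1, by linear_combination h2⟩

/-! ### Quaternions as pairs of complex numbers. -/

@[simp] theorem quat_re (a b : ℂ) : (quat a b).re = a.re := rfl

@[simp] theorem quat_imI (a b : ℂ) : (quat a b).imI = a.im := rfl

@[simp] theorem quat_imJ (a b : ℂ) : (quat a b).imJ = b.re := rfl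

@[simp] theorem quat_imK (a b : ℂ) : (quat a b).imK = b.im := rfl

theorem quat_mul (a b c e : ℂ) :
    quat a b * quat c e = quat (a * c - b * star e) (a * e + b * star c) := by
  ext <;> simp <;> ring

theorem quat_add (a b c e : ℂ) : quat a b + quat c e = quat (a + c) (b + e) := by
  ext <;> simp

theorem quat_co (q : ℍ[ℝ]) : quat (co1 q) (co2 q) = q := by
  ext <;> simp [co1, co2]

theorem co1_quat (a b : ℂ) : co1 (quat a b) = a := by
  apply Complex.ext <;> simp [co1]

theorem co2_quat (a b : ℂ) : co2 (quat a b) = b := by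
  apply Complex.ext <;> simp [co2]

theorem quat_inj {a b c e : ℂ} : quat a b = quat c e ↔ a = c ∧ b = e := by
  constructor
  · intro h
    exact ⟨by rw [← co1_quat a b, h, co1_quat], by rw [← co2_quat a b, h, co2_quat]⟩
  · rintro ⟨rfl, rfl⟩; rfl

theorem quat_eq_zero_iff {a b : ℂ} : quat a b = 0 ↔ a = 0 ∧ b = 0 := by
  have : (0 : ℍ[ℝ]) = quat 0 0 := by ext <;> simp
  rw [this, quat_inj]

theorem quat_I_mul_quat_I : quat Complex.I 0 * quat Complex.I 0 = -1 := by
  ext <;> simp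

theorem quat_I_mem : quat Complex.I 0 ∈ unitSphere := quat_I_mul_quat_I

theorem quat_zero_right (v : ℂ) : quat v 0 = (v.re : ℍ[ℝ]) + v.im • quat Complex.I 0 := by
  ext <;> simp

/-! ### Maps `ℂ → ℍ` whose two complex components are polynomials -/

/-- The two complex components of `f` are polynomials. -/
def IsPolynomialMap (f : ℂ → ℍ[ℝ]) : Prop :=
  ∃ g h : Polynomial ℂ, ∀ z, f z = quat (g.eval z) (h.eval z)

theorem IsPolynomialMap.add {f₁ f₂ : ℂ → ℍ[ℝ]} (h₁ : IsPolynomialMap f₁)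
    (h₂ : IsPolynomialMap f₂) : IsPolynomialMap fun z => f₁ z + f₂ z := by
  obtain ⟨a, b, h₁⟩ := h₁
  obtain ⟨c, e, h₂⟩ := h₂
  exact ⟨a + c, b + e, fun z => by simp [h₁, h₂, quat_add]⟩

/-- Left factors are restricted to `ℂ_i`: left multiplication by `j` would conjugate the components.
Right factors may be arbitrary. -/
theorem IsPolynomialMap.const_mul {f : ℂ → ℍ[ℝ]} (c : ℂ) (hf : IsPolynomialMap f) :
    IsPolynomialMap fun z => quat c 0 * f z := by
  obtain ⟨a, b, hf⟩ := hf
  exact ⟨Polynomial.C c * a, Polynomial.C c * b, fun z => by simp [hf, quat_mul]⟩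

theorem IsPolynomialMap.mul_const {f : ℂ → ℍ[ℝ]} (hf : IsPolynomialMap f) (q : ℍ[ℝ]) :
    IsPolynomialMap fun z => f z * q := by
  obtain ⟨a, b, hf⟩ := hf
  refine ⟨a * Polynomial.C (co1 q) - b * Polynomial.C (star (co2 q)),
    a * Polynomial.C (co2 q) + b * Polynomial.C (star (co1 q)), fun z => ?_⟩
  dsimp only
  rw [hf, ← quat_co q, quat_mul]
  simp [co1_quat, co2_quat]

theorem IsPolynomialMap.sum {ι : Type*} (s : Finset ι) {f : ι → ℂ → ℍ[ℝ]}
    (hf : ∀ i, IsPolynomialMap (f i)) : IsPolynomialMap fun z => ∑ i ∈ s, f i z := by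
  classical
  induction s using Finset.induction_on with
  | empty => exact ⟨0, 0, fun z => by simp [quat_eq_zero_iff.2]⟩
  | insert i s hi ih =>
    simp only [Finset.sum_insert hi]
    exact (hf i).add ih

/-- The value `∑ zⁿ aₙ`, with the powers on the left, of a quaternionic polynomial at `z ∈ ℂ_i`. -/
noncomputable def polyVal (p : Polynomial ℍ[ℝ]) (z : ℂ) : ℍ[ℝ] := p.sum fun n a => quat (z ^ n) 0 * a

theorem isPolynomialMap_polyVal (p : Polynomial ℍ[ℝ]) : IsPolynomialMap (polyVal p) := by
  refine IsPolynomialMap.sum p.support fun n => ?_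
  exact IsPolynomialMap.mul_const ⟨.X ^ n, 0, fun z => by simp⟩ _

/-! ### The common stem function of `P` and its companion. -/

theorem polyStem_add (p : Polynomial ℍ[ℝ]) (z : ℂ) :
    (polyStem p z).fst + quat Complex.I 0 * (polyStem p z).snd = polyVal p z := by
  simp only [polyStem, polyVal, Polynomial.sum, Finset.mul_sum, ← Finset.sum_add_distrib]
  refine Finset.sum_congr rfl fun n _ => ?_
  rw [quat_zero_right (z ^ n), add_mul, mul_smul_comm, smul_mul_assoc, Quaternion.coe_mul_eq_smul]

theorem polyStem_star (p : Polynomial ℍ[ℝ]) (z : ℂ) :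
    polyStem p (star z) = ⟨(polyStem p z).fst, -(polyStem p z).snd⟩ := by
  have h : ∀ n : ℕ, (star z) ^ n = star (z ^ n) := fun n => (star_pow z n).symm
  simp [polyStem, Polynomial.sum, ← map_pow]

/-- The stem function that agrees with `peirceStem J p m` on the upper half plane and with
`peirceStem J m p` on the lower one. -/
noncomputable def upperStem (J : ℍ[ℝ]) (p m : Polynomial ℍ[ℝ]) (z : ℂ) : HC :=
  ⟨(1 / 2 : ℝ) • ((polyStem p z).fst + (polyStem p z).snd * J +
      (polyStem m z).fst - (polyStem m z).snd * J),
    (1 / 2 : ℝ) • ((polyStem p z).snd - (polyStem p z).fst * J +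
      (polyStem m z).snd + (polyStem m z).fst * J)⟩

theorem HC.add_def (x y : HC) : x + y = ⟨x.fst + y.fst, x.snd + y.snd⟩ := rfl

theorem HC.mul_def (x y : HC) :
    x * y = ⟨x.fst * y.fst - x.snd * y.snd, x.fst * y.snd + x.snd * y.fst⟩ := rfl

theorem peirceStem_of_pos (J : ℍ[ℝ]) (p m : Polynomial ℍ[ℝ]) {z : ℂ} (hz : 0 < z.im) :
    peirceStem J p m z = upperStem J p m z := by
  simp only [peirceStem, upperStem, stemPlus, stemMinus, if_pos hz, HC.add_def, HC.mul_def,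
    mul_neg, mul_smul_comm, mul_one]
  congr 1 <;> module

/-- Crossing the real axis exchanges the stem values of `ℓ₊` and `ℓ₋`; swapping the two polynomials,
as the companion does, undoes this. -/
theorem peirceStem_of_neg (J : ℍ[ℝ]) (p m : Polynomial ℍ[ℝ]) {z : ℂ} (hz : z.im < 0) :
    peirceStem J m p z = upperStem J p m z := by
  simp only [peirceStem, upperStem, stemPlus, stemMinus, if_neg hz.not_gt, HC.add_def, HC.mul_def,
    mul_neg, mul_smul_comm, mul_one]
  congr 1 <;> module

theorem upperStem_swap (J : ℍ[ℝ]) (p m : Polynomial ℍ[ℝ]) (z : ℂ) :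
    upperStem J m p z = ⟨(upperStem J p m (star z)).fst, -(upperStem J p m (star z)).snd⟩ := by
  simp only [upperStem, polyStem_star, neg_mul]
  congr 1 <;> module

theorem isPolynomialMap_upperStem_add (J : ℍ[ℝ]) (p m : Polynomial ℍ[ℝ]) :
    IsPolynomialMap fun z =>
      (upperStem J p m z).fst + quat Complex.I 0 * (upperStem J p m z).snd := by
  have key : ∀ z, (upperStem J p m z).fst + quat Complex.I 0 * (upperStem J p m z).snd =
      quat (1 / 2 : ℂ) 0 * (polyVal p z + quat (-Complex.I) 0 * polyVal p z * J + polyVal m z +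
        quat Complex.I 0 * polyVal m z * J) := by
    intro z
    have h1 : ∀ q : ℍ[ℝ], quat (1 / 2 : ℂ) 0 * q = (1 / 2 : ℝ) • q := by
      intro q
      rw [← Quaternion.coe_mul_eq_smul]
      congr 1
      ext <;> simp [-Quaternion.coe_inv]
    have h2 : quat (-Complex.I) 0 = - quat Complex.I 0 := by ext <;> simp
    rw [h1, h2, ← polyStem_add, ← polyStem_add]
    simp only [upperStem, mul_add, mul_sub, add_mul, mul_smul_comm, ← mul_assoc, neg_mul,
      quat_I_mul_quat_I, one_mul]
    module
  simp only [key]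
  have hp := isPolynomialMap_polyVal p
  have hm := isPolynomialMap_polyVal m
  exact ((((hp.add ((hp.const_mul _).mul_const J)).add hm).add
    ((hm.const_mul _).mul_const J))).const_mul _

theorem exists_splitting (J : ℍ[ℝ]) (p m : Polynomial ℍ[ℝ]) :
    ∃ g g' h h' : Polynomial ℂ, ∀ z,
      (upperStem J p m z).fst + quat Complex.I 0 * (upperStem J p m z).snd =
        quat (g.eval z) (h.eval z) ∧
      (upperStem J p m z).fst - quat Complex.I 0 * (upperStem J p m z).snd =
        quat (star (g'.eval z)) (star (h'.eval z)) := by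
  obtain ⟨g, h, hgh⟩ := isPolynomialMap_upperStem_add J p m
  obtain ⟨k, l, hkl⟩ := isPolynomialMap_upperStem_add J m p
  refine ⟨g, k.map (starRingEnd ℂ), h, l.map (starRingEnd ℂ), fun z => ⟨hgh z, ?_⟩⟩
  have h1 : ∀ r : Polynomial ℂ, star ((r.map (starRingEnd ℂ)).eval z) = r.eval (star z) := by
    intro r
    have := Polynomial.hom_eval₂ r (starRingEnd ℂ) (starRingEnd ℂ) z
    rw [show (starRingEnd ℂ).comp (starRingEnd ℂ) = RingHom.id ℂ from
      RingHom.ext fun x => star_star x] at this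
    rw [Polynomial.eval_map]
    exact this
  rw [h1, h1, ← hkl]
  simp only [upperStem_swap J p m, star_star, mul_neg, sub_eq_add_neg]

/-- Since `i j = -j i`, the part `s` meets `x.fst + i x.snd` and the part `u j` meets `x.fst - i
x.snd`; moving `j` past the latter removes the conjugations. -/
theorem mul_upperStem {s u : ℂ} {x : HC} {g g' h h' : ℂ}
    (h1 : x.fst + quat Complex.I 0 * x.snd = quat g h)
    (h2 : x.fst - quat Complex.I 0 * x.snd = quat (star g') (star h')) :
    quat s u * x.fst + quat Complex.I 0 * quat s u * x.snd =
      quat (s * g - u * h') (s * h + u * g') := by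
  obtain ⟨q, r⟩ := x
  dsimp only at *
  rw [← quat_co q, ← quat_co r] at *
  generalize co1 q = a at *
  generalize co2 q = b at *
  generalize co1 r = c at *
  generalize co2 r = e at *
  rw [sub_eq_add_neg, ← mul_neg] at h2
  have h3 : -quat c e = quat (-c) (-e) := by ext <;> simp
  rw [h3] at h2
  simp only [quat_mul, quat_add, quat_inj] at *
  simp only [zero_mul, sub_zero, add_zero] at *
  have h4 := congrArg star h2.1
  have h5 := congrArg star h2.2
  simp only [star_star, star_add, star_mul', star_neg] at h4 h5 ⊢
  simp only [Complex.star_def, Complex.conj_I] at h4 h5 ⊢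
  constructor
  · linear_combination s * h1.1 - u * h5
  · linear_combination s * h1.2 + u * h4

/-- The data of a slice-polynomial function and its companion in terms of the common stem function
`x` on `ℂ` and of the four polynomials of the splitting. -/
structure LiftData (P Pv : ℍ[ℝ] → ℍ[ℝ]) (x : ℂ → HC) (g g' h h' : Polynomial ℂ) : Prop where
  continuous_fst : Continuous fun z => (x z).fst
  continuous_snd : Continuous fun z => (x z).snd
  pos : ∀ I ∈ unitSphere, ∀ z : ℂ, 0 < z.im → P (slicePt I z) = (x z).fst + I * (x z).snd
  neg : ∀ I ∈ unitSphere, ∀ z : ℂ, z.im < 0 → Pv (slicePt I z) = (x z).fst + I * (x z).snd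
  neg' : ∀ I ∈ unitSphere, ∀ z : ℂ, z.im < 0 →
    P (slicePt I z) = (x (star z)).fst - I * (x (star z)).snd
  add : ∀ z, (x z).fst + quat Complex.I 0 * (x z).snd = quat (g.eval z) (h.eval z)
  sub : ∀ z, (x z).fst - quat Complex.I 0 * (x z).snd =
    quat (star (g'.eval z)) (star (h'.eval z))

theorem continuous_polyStem_fst (p : Polynomial ℍ[ℝ]) : Continuous fun z => (polyStem p z).fst := by
  unfold polyStem Polynomial.sum
  fun_prop

theorem continuous_polyStem_snd (p : Polynomial ℍ[ℝ]) : Continuous fun z => (polyStem p z).snd := by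
  unfold polyStem Polynomial.sum
  fun_prop

theorem IsCompanion.exists_liftData {P Pv : ℍ[ℝ] → ℍ[ℝ]} (hPv : IsCompanion P Pv) :
    ∃ x g g' h h', LiftData P Pv x g g' h h' := by
  obtain ⟨J, -, p, m, hP, hPv⟩ := hPv
  obtain ⟨g, g', h, h', hs⟩ := exists_splitting J p m
  have c1 := continuous_polyStem_fst p
  have c2 := continuous_polyStem_snd p
  have c3 := continuous_polyStem_fst m
  have c4 := continuous_polyStem_snd m
  refine ⟨upperStem J p m, g, g', h, h', ?_, ?_, ?_, ?_, ?_, fun z => (hs z).1, fun z => (hs z).2⟩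
  · unfold upperStem; fun_prop
  · unfold upperStem; fun_prop
  · intro I hI z hz
    rw [hP I hI z hz.ne', peirceStem_of_pos J p m hz]
  · intro I hI z hz
    rw [hPv I hI z hz.ne, peirceStem_of_neg J p m hz]
  · intro I hI z hz
    rw [hP I hI z hz.ne, peirceStem_of_neg J m p hz, upperStem_swap J p m]
    simp only [mul_neg, sub_eq_add_neg]

theorem slicePt_quat_I (z : ℂ) : slicePt (quat Complex.I 0) z = quat z 0 := by
  rw [slicePt, ← quat_zero_right]

theorem LiftData.splitsAs {P Pv : ℍ[ℝ] → ℍ[ℝ]} {x : ℂ → HC} {g g' h h' : Polynomial ℂ}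
    (D : LiftData P Pv x g g' h h') : SplitsAs P g g' h h' := by
  constructor
  · intro v hv
    rw [← slicePt_quat_I, D.pos _ quat_I_mem v hv, D.add]
  · intro v hv
    rw [← slicePt_quat_I, D.neg' _ quat_I_mem v hv, D.sub]

/-! ### The twistor degree. -/

theorem polynomial_eq_of_forall_eval_eq {p q : Polynomial ℂ}
    (h : ∀ v : ℂ, 0 < v.im → p.eval v = q.eval v) : p = q := by
  refine Polynomial.eq_of_infinite_eval_eq p q (Set.Infinite.mono (s := Set.range
    fun n : ℕ => ((n : ℂ) + Complex.I)) ?_ (Set.infinite_range_of_injective fun a b hab => ?_))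
  · rintro _ ⟨n, rfl⟩
    exact h _ (by simp)
  · simpa using hab

theorem SplitsAs.unique {P : ℍ[ℝ] → ℍ[ℝ]} {g g' h h' k k' l l' : Polynomial ℂ}
    (h₁ : SplitsAs P g g' h h') (h₂ : SplitsAs P k k' l l') :
    g = k ∧ g' = k' ∧ h = l ∧ h' = l' := by
  have hp : ∀ v : ℂ, 0 < v.im → g.eval v = k.eval v ∧ h.eval v = l.eval v := fun v hv =>
    quat_inj.1 ((h₁.1 v hv).symm.trans (h₂.1 v hv))
  have hm : ∀ v : ℂ, 0 < v.im → g'.eval v = k'.eval v ∧ h'.eval v = l'.eval v := fun v hv => by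
    have hv' : (star v).im < 0 := by simpa using hv
    have := quat_inj.1 ((h₁.2 _ hv').symm.trans (h₂.2 _ hv'))
    simpa only [star_inj, star_star] using this
  exact ⟨polynomial_eq_of_forall_eval_eq fun v hv => (hp v hv).1,
    polynomial_eq_of_forall_eval_eq fun v hv => (hm v hv).1,
    polynomial_eq_of_forall_eval_eq fun v hv => (hp v hv).2,
    polynomial_eq_of_forall_eval_eq fun v hv => (hm v hv).2⟩

open Polynomial in
theorem detPoly_eq (g g' h h' : ℂ[X]) (q : ℍ[ℝ]) :
    detPoly g g' h h' q = (g * g' + h * h') - C (star (co1 q)) * g - C (co1 q) * g' -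
      C (star (co2 q)) * h - C (co2 q) * h' +
      C (co1 q * star (co1 q) + co2 q * star (co2 q)) := by
  simp only [detPoly, C_add, C_mul]
  ring

/-- The twistor degree as a maximum of five degrees. -/
theorem SplitsAs.twistorDegree_eq {P : ℍ[ℝ] → ℍ[ℝ]} {g g' h h' : Polynomial ℂ}
    (hs : SplitsAs P g g' h h') :
    g.natDegree ≤ twistorDegree P ∧ g'.natDegree ≤ twistorDegree P ∧
    h.natDegree ≤ twistorDegree P ∧ h'.natDegree ≤ twistorDegree P ∧
    (g * g' + h * h').natDegree ≤ twistorDegree P ∧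
    (twistorDegree P ≠ 0 → ¬ (g.coeff (twistorDegree P) = 0 ∧ g'.coeff (twistorDegree P) = 0 ∧
      h.coeff (twistorDegree P) = 0 ∧ h'.coeff (twistorDegree P) = 0 ∧
      (g * g' + h * h').coeff (twistorDegree P) = 0)) := by
  set d := max (max (max g.natDegree g'.natDegree) (max h.natDegree h'.natDegree))
    (g * g' + h * h').natDegree with hd
  have hg : g.natDegree ≤ d := by simp [hd]
  have hg' : g'.natDegree ≤ d := by simp [hd]
  have hh : h.natDegree ≤ d := by simp [hd]
  have hh' : h'.natDegree ≤ d := by simp [hd]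
  have hw : (g * g' + h * h').natDegree ≤ d := by simp [hd]
  have hcoeff : d ≠ 0 → ¬ (g.coeff d = 0 ∧ g'.coeff d = 0 ∧ h.coeff d = 0 ∧ h'.coeff d = 0 ∧
      (g * g' + h * h').coeff d = 0) := by
    rintro hd0 ⟨h1, h2, h3, h4, h5⟩
    have key : ∀ p : Polynomial ℂ, p.coeff d = 0 → p.natDegree ≠ d := by
      intro p hp hpd
      rw [← hpd, Polynomial.coeff_natDegree, Polynomial.leadingCoeff_eq_zero] at hp
      rw [hp, Polynomial.natDegree_zero] at hpd
      exact hd0 hpd.symm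
    have := key _ h1
    have := key _ h2
    have := key _ h3
    have := key _ h4
    have := key _ h5
    omega
  have hle : ∀ q, (detPoly g g' h h' q).natDegree ≤ d := by
    intro q
    have hC : ∀ (c : ℂ) (p : Polynomial ℂ), p.natDegree ≤ d →
        (Polynomial.C c * p).natDegree ≤ d := fun c p hp =>
      (Polynomial.natDegree_C_mul_le _ _).trans hp
    have hsub : ∀ p r : Polynomial ℂ, p.natDegree ≤ d → r.natDegree ≤ d →
        (p - r).natDegree ≤ d := fun p r hp hr =>
      (Polynomial.natDegree_sub_le_of_le hp hr).trans (max_self d).le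
    rw [detPoly_eq]
    refine Polynomial.natDegree_add_le_of_degree_le ?_
      (by rw [Polynomial.natDegree_C]; exact Nat.zero_le _)
    exact hsub _ _ (hsub _ _ (hsub _ _ (hsub _ _ hw (hC _ _ hg)) (hC _ _ hg')) (hC _ _ hh))
      (hC _ _ hh')
  have hex : ∃ q, (detPoly g g' h h' q).natDegree = d := by
    by_cases hd0 : d = 0
    · exact ⟨0, Nat.le_antisymm (hle 0) (by rw [hd0]; exact Nat.zero_le _)⟩
    by_contra! H
    -- The coefficient of `v ^ d` in `D_q` is affine in `q₁, q₂` and their conjugates. Testing `q₁`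
    -- and `q₂` at `0, 1, i` separates the five coefficients.
    have hz : ∀ a b : ℂ, (g * g' + h * h').coeff d - star a * g.coeff d - a * g'.coeff d -
        star b * h.coeff d - b * h'.coeff d = 0 := by
      intro a b
      have h1 := Polynomial.coeff_eq_zero_of_natDegree_lt
        (lt_of_le_of_ne (hle (quat a b)) (H (quat a b)))
      rw [detPoly_eq, co1_quat, co2_quat] at h1
      simpa [Polynomial.coeff_C_of_ne_zero hd0] using h1
    have h0 := hz 0 0
    simp only [star_zero, zero_mul, sub_zero] at h0
    have h1 := hz 1 0
    have h2 := hz Complex.I 0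
    have h3 := hz 0 1
    have h4 := hz 0 Complex.I
    simp only [h0, star_zero, star_one, zero_mul, sub_zero, one_mul, Complex.star_def,
      Complex.conj_I, zero_sub] at h1 h2 h3 h4
    have hI := Complex.I_mul_I
    refine hcoeff hd0 ⟨?_, ?_, ?_, ?_, h0⟩
    · linear_combination (-1 / 2 : ℂ) * h1 - Complex.I / 2 * h2 + (g.coeff d - g'.coeff d) / 2 * hI
    · linear_combination (-1 / 2 : ℂ) * h1 + Complex.I / 2 * h2 - (g.coeff d - g'.coeff d) / 2 * hI
    · linear_combination (-1 / 2 : ℂ) * h3 - Complex.I / 2 * h4 + (h.coeff d - h'.coeff d) / 2 * hI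
    · linear_combination (-1 / 2 : ℂ) * h3 + Complex.I / 2 * h4 - (h.coeff d - h'.coeff d) / 2 * hI
  have htd : twistorDegree P = d := by
    refine IsGreatest.csSup_eq ⟨?_, ?_⟩
    · obtain ⟨q, hq⟩ := hex
      exact ⟨g, g', h, h', hs, q, hq.symm⟩
    · rintro n ⟨k, k', l, l', hk, q, rfl⟩
      obtain ⟨rfl, rfl, rfl, rfl⟩ := hs.unique hk
      exact hle q
  rw [htd]
  exact ⟨hg, hg', hh, hh', hw, hcoeff⟩

/-! ### The quadric and the explicit form of the lift. -/

theorem re_eq_zero_of_mem_unitSphere {I : ℍ[ℝ]} (hI : I ∈ unitSphere) : I.re = 0 := by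
  have h : I * I = -1 := hI
  have h0 := congrArg QuaternionAlgebra.re h
  have h1 := congrArg QuaternionAlgebra.imI h
  have h2 := congrArg QuaternionAlgebra.imJ h
  have h3 := congrArg QuaternionAlgebra.imK h
  simp at h0 h1 h2 h3
  by_contra hr
  have e1 : I.imI = 0 := by
    have : I.re * I.imI = 0 := by linarith
    exact (mul_eq_zero.1 this).resolve_left hr
  have e2 : I.imJ = 0 := by
    have : I.re * I.imJ = 0 := by linarith
    exact (mul_eq_zero.1 this).resolve_left hr
  have e3 : I.imK = 0 := by
    have : I.re * I.imK = 0 := by linarith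
    exact (mul_eq_zero.1 this).resolve_left hr
  rw [e1, e2, e3] at h0
  nlinarith [sq_nonneg I.re]

/-- Homogeneous coordinates `[s, u, s v, u v]` on the quadric. -/
noncomputable def quadricCoords (s u v : ℂ) : Fin 4 → ℂ := ![s, u, s * v, u * v]

theorem inPlus_quadricCoords {s u v : ℂ} (h : ¬ (s = 0 ∧ u = 0)) :
    InPlus (quadricCoords s u v) ↔ 0 < v.im := by
  simp only [InPlus, quadricCoords, Matrix.cons_val]
  constructor
  · rintro (⟨h1, h2⟩ | ⟨h1, h2⟩)
    · rwa [mul_div_cancel_left₀ _ h1] at h2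
    · rwa [mul_div_cancel_left₀ _ h1] at h2
  · intro hv
    by_cases h1 : s = 0
    · have h2 : u ≠ 0 := fun h2 => h ⟨h1, h2⟩
      exact Or.inr ⟨h2, by rwa [mul_div_cancel_left₀ _ h2]⟩
    · exact Or.inl ⟨h1, by rwa [mul_div_cancel_left₀ _ h1]⟩

theorem inMinus_quadricCoords {s u v : ℂ} (h : ¬ (s = 0 ∧ u = 0)) :
    InMinus (quadricCoords s u v) ↔ v.im < 0 := by
  simp only [InMinus, quadricCoords, Matrix.cons_val]
  constructor
  · rintro (⟨h1, h2⟩ | ⟨h1, h2⟩)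
    · rwa [mul_div_cancel_left₀ _ h1] at h2
    · rwa [mul_div_cancel_left₀ _ h1] at h2
  · intro hv
    by_cases h1 : s = 0
    · have h2 : u ≠ 0 := fun h2 => h ⟨h1, h2⟩
      exact Or.inr ⟨h2, by rwa [mul_div_cancel_left₀ _ h2]⟩
    · exact Or.inl ⟨h1, by rwa [mul_div_cancel_left₀ _ h1]⟩

theorem denom_quadricCoords (s u v : ℂ) : denom (quadricCoords s u v) = quat s u := rfl

theorem unitOf_mem {X : Fin 4 → ℂ} (h : denom X ≠ 0) : unitOf X ∈ unitSphere := by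
  change unitOf X * unitOf X = -1
  rw [unitOf]
  calc (denom X)⁻¹ * quat Complex.I 0 * denom X * ((denom X)⁻¹ * quat Complex.I 0 * denom X)
      = (denom X)⁻¹ * quat Complex.I 0 * (denom X * (denom X)⁻¹) * quat Complex.I 0 * denom X := by
        simp only [mul_assoc]
    _ = (denom X)⁻¹ * (quat Complex.I 0 * quat Complex.I 0) * denom X := by
        rw [mul_inv_cancel₀ h, mul_one, mul_assoc (denom X)⁻¹]
    _ = -1 := by rw [quat_I_mul_quat_I, mul_neg_one, neg_mul, inv_mul_cancel₀ h]

theorem twistorProj_quadricCoords {s u v : ℂ} (h : ¬ (s = 0 ∧ u = 0)) :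
    twistorProj (quadricCoords s u v) = slicePt (unitOf (quadricCoords s u v)) v := by
  have hq : quat s u ≠ 0 := fun h0 => h (quat_eq_zero_iff.1 h0)
  have h1 : quat (quadricCoords s u v 2) (quadricCoords s u v 3) = quat v 0 * quat s u := by
    simp [quadricCoords, quat_mul, mul_comm]
  rw [twistorProj, slicePt, unitOf, denom_quadricCoords, h1, quat_zero_right, add_mul, mul_add,
    Quaternion.coe_commutes, ← mul_assoc, inv_mul_cancel₀ hq, one_mul, smul_mul_assoc,
    mul_smul_comm, mul_assoc]

theorem slicePt_re {I : ℍ[ℝ]} (hI : I ∈ unitSphere) (z : ℂ) : (slicePt I z).re = z.re := by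
  simp [slicePt, re_eq_zero_of_mem_unitSphere hI]

/-- The three cases of the definition merge because `x` is one continuous function on `ℂ`; over the
reals the limit is its value. -/
theorem LiftData.liftBase_eq {P Pv : ℍ[ℝ] → ℍ[ℝ]} {x : ℂ → HC} {g g' h h' : Polynomial ℂ}
    (D : LiftData P Pv x g g' h h') {s u v : ℂ} (hsu : ¬ (s = 0 ∧ u = 0)) :
    liftBase P Pv (quadricCoords s u v) =
      (x v).fst + unitOf (quadricCoords s u v) * (x v).snd := by
  have hI : unitOf (quadricCoords s u v) ∈ unitSphere :=
    unitOf_mem fun h0 => hsu (quat_eq_zero_iff.1 h0)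
  rw [liftBase, inPlus_quadricCoords hsu, inMinus_quadricCoords hsu,
    twistorProj_quadricCoords hsu, slicePt_re hI]
  split_ifs with h1 h2
  · exact D.pos _ hI v h1
  · exact D.neg _ hI v h2
  · have hv : v.im = 0 := le_antisymm (not_lt.1 h1) (not_lt.1 h2)
    rw [realExt]
    apply Filter.Tendsto.limUnder_eq
    set I := unitOf (quadricCoords s u v)
    have hcont : Continuous fun z => (x z).fst + I * (x z).snd :=
      D.continuous_fst.add (continuous_const.mul D.continuous_snd)
    have hline : Continuous fun β : ℝ => (⟨v.re, β⟩ : ℂ) := by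
      have : (fun β : ℝ => (⟨v.re, β⟩ : ℂ)) = fun β : ℝ => (v.re : ℂ) + β * Complex.I := by
        funext β
        apply Complex.ext <;> simp
      rw [this]
      fun_prop
    have hlim := (hcont.comp hline).tendsto 0
    have hv0 : (⟨v.re, 0⟩ : ℂ) = v := Complex.ext rfl hv.symm
    simp only [Function.comp_apply, hv0] at hlim
    refine (hlim.mono_left nhdsWithin_le_nhds).congr' ?_
    filter_upwards [self_mem_nhdsWithin] with β hβ
    exact (D.pos I hI ⟨v.re, β⟩ hβ).symm

/-- The explicit form of the extended twistor lift. -/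
theorem LiftData.liftVec_eq {P Pv : ℍ[ℝ] → ℍ[ℝ]} {x : ℂ → HC} {g g' h h' : Polynomial ℂ}
    (D : LiftData P Pv x g g' h h') {s u v : ℂ} (hsu : ¬ (s = 0 ∧ u = 0)) :
    liftVec P Pv (quadricCoords s u v) = liftCoords g g' h h' s u v := by
  have hq : quat s u ≠ 0 := fun h0 => hsu (quat_eq_zero_iff.1 h0)
  have h1 : denom (quadricCoords s u v) * liftBase P Pv (quadricCoords s u v) =
      quat (s * g.eval v - u * h'.eval v) (s * h.eval v + u * g'.eval v) := by
    rw [D.liftBase_eq hsu, ← mul_upperStem (D.add v) (D.sub v), mul_add, unitOf,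
      denom_quadricCoords, ← mul_assoc, ← mul_assoc, ← mul_assoc, mul_inv_cancel₀ hq, one_mul]
  rw [liftVec, h1, co1_quat, co2_quat]
  rfl

theorem quadricCoords_ne_zero {s u : ℂ} (v : ℂ) (h : ¬ (s = 0 ∧ u = 0)) :
    quadricCoords s u v ≠ 0 := fun h0 => h ⟨congrFun h0 0, congrFun h0 1⟩

theorem exists_smul_eq_rep_mk {w : Fin 4 → ℂ} (hw : w ≠ 0) :
    ∃ a : ℂ, a ≠ 0 ∧ (Projectivization.mk ℂ w hw).rep = a • w := by
  obtain ⟨a, ha⟩ := Projectivization.exists_smul_eq_mk_rep ℂ w hw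
  exact ⟨a, a.ne_zero, ha.symm⟩

/-- The point `[s, u, s v, u v]` of the quadric. -/
noncomputable def quadricPoint (s u v : ℂ) (h : ¬ (s = 0 ∧ u = 0)) : Quadric :=
  ⟨Projectivization.mk ℂ (quadricCoords s u v) (quadricCoords_ne_zero v h), by
    obtain ⟨a, ha, hrep⟩ := exists_smul_eq_rep_mk (quadricCoords_ne_zero v h)
    rw [hrep]
    refine ⟨by simp [quadricCoords]; ring, fun h0 => h ?_⟩
    simpa [quadricCoords, ha] using h0⟩

theorem Quadric.exists_rep_eq (X : Quadric) :
    ∃ s u v : ℂ, ¬ (s = 0 ∧ u = 0) ∧ X.1.rep = quadricCoords s u v := by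
  obtain ⟨h1, h2⟩ := X.2
  by_cases h0 : X.1.rep 0 = 0
  · have h3 : X.1.rep 1 ≠ 0 := fun h3 => h2 ⟨h0, h3⟩
    refine ⟨_, _, X.1.rep 3 / X.1.rep 1, h2, ?_⟩
    rw [h0, zero_mul] at h1
    have h4 := (mul_eq_zero.1 h1.symm).resolve_left h3
    funext i
    fin_cases i
    · rfl
    · rfl
    · simp [quadricCoords, h0, h4]
    · simp [quadricCoords]; field_simp
  · refine ⟨_, _, X.1.rep 2 / X.1.rep 0, h2, ?_⟩
    funext i
    fin_cases i
    · rfl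
    · rfl
    · simp [quadricCoords]; field_simp
    · simp [quadricCoords]; field_simp; linear_combination h1

theorem Quadric.eq_quadricPoint {X : Quadric} {s u v a : ℂ} (h : ¬ (s = 0 ∧ u = 0))
    (hX : X.1.rep = a • quadricCoords s u v) : X = quadricPoint s u v h := by
  apply Subtype.ext
  rw [← X.1.mk_rep]
  exact (Projectivization.mk_eq_mk_iff' ℂ _ _ _ _).2 ⟨a, hX.symm⟩

theorem liftCoords_ne_zero (g g' h h' : Polynomial ℂ) {s u : ℂ} (v : ℂ)
    (hsu : ¬ (s = 0 ∧ u = 0)) : liftCoords g g' h h' s u v ≠ 0 :=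
  fun h0 => hsu ⟨congrFun h0 0, congrFun h0 1⟩

theorem LiftData.extendedTwistorLift_eq {P Pv : ℍ[ℝ] → ℍ[ℝ]} {x : ℂ → HC}
    {g g' h h' : Polynomial ℂ} (D : LiftData P Pv x g g' h h') {X : Quadric} {s u v : ℂ}
    (hsu : ¬ (s = 0 ∧ u = 0)) (hX : X.1.rep = quadricCoords s u v) :
    extendedTwistorLift P Pv X =
      Projectivization.mk ℂ (liftCoords g g' h h' s u v) (liftCoords_ne_zero _ _ _ _ v hsu) := by
  have h1 : liftVec P Pv X.1.rep = liftCoords g g' h h' s u v := by rw [hX, D.liftVec_eq hsu]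
  simp only [extendedTwistorLift, h1]

theorem LiftData.extendedTwistorLift_quadricPoint {P Pv : ℍ[ℝ] → ℍ[ℝ]} {x : ℂ → HC}
    {g g' h h' : Polynomial ℂ} (D : LiftData P Pv x g g' h h') {s u : ℂ} (v : ℂ)
    (hsu : ¬ (s = 0 ∧ u = 0)) :
    extendedTwistorLift P Pv (quadricPoint s u v hsu) =
      Projectivization.mk ℂ (liftCoords g g' h h' s u v) (liftCoords_ne_zero _ _ _ _ v hsu) := by
  obtain ⟨a, ha, hrep⟩ := exists_smul_eq_rep_mk (quadricCoords_ne_zero v hsu)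
  have h1 : (quadricPoint s u v hsu).1.rep = quadricCoords (a * s) (a * u) v := by
    refine hrep.trans ?_
    funext i
    fin_cases i <;> simp [quadricCoords, mul_assoc]
  rw [D.extendedTwistorLift_eq (by simpa [ha] using hsu) h1]
  exact (Projectivization.mk_eq_mk_iff' ℂ _ _ _ _).2 ⟨a, (liftCoords_smul _ _ _ _ _ _ _ _).symm⟩

theorem eval_rep_mk_eq_zero_iff {F : MvPolynomial (Fin 4) ℂ} {n : ℕ} (hF : F.IsHomogeneous n)
    {w : Fin 4 → ℂ} (hw : w ≠ 0) :
    MvPolynomial.eval (Projectivization.mk ℂ w hw).rep F = 0 ↔ MvPolynomial.eval w F = 0 := by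
  obtain ⟨a, ha, hrep⟩ := exists_smul_eq_rep_mk hw
  rw [hrep, hF.eval_smul_eq]
  simp [ha]

/-- The lift preserves `[s, u]`, so points with the same image differ only in `v`. -/
theorem LiftData.encard_fibre {P Pv : ℍ[ℝ] → ℍ[ℝ]} {x : ℂ → HC}
    {g g' h h' : Polynomial ℂ} (D : LiftData P Pv x g g' h h') {s u v : ℂ}
    (hsu : ¬ (s = 0 ∧ u = 0)) :
    (extendedTwistorLift P Pv ⁻¹' {extendedTwistorLift P Pv (quadricPoint s u v hsu)}).encard =
      {v' | liftCoords g g' h h' s u v' = liftCoords g g' h h' s u v}.encard := by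
  have hinj : Function.Injective fun v' => quadricPoint s u v' hsu := by
    intro v₁ v₂ h12
    have h1 := congrArg Subtype.val h12
    obtain ⟨a, ha⟩ := (Projectivization.mk_eq_mk_iff' ℂ _ _ _ _).1 h1
    have e0 : a * s = s := congrFun ha 0
    have e1 : a * u = u := congrFun ha 1
    have e2 : a * (s * v₂) = s * v₁ := congrFun ha 2
    have e3 : a * (u * v₂) = u * v₁ := congrFun ha 3
    rw [← mul_assoc, e0] at e2
    rw [← mul_assoc, e1] at e3
    by_cases hs : s = 0
    · exact (mul_left_cancel₀ (fun hu => hsu ⟨hs, hu⟩) e3).symm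
    · exact (mul_left_cancel₀ hs e2).symm
  rw [← hinj.encard_image]
  congr 1
  ext X
  simp only [Set.mem_preimage, Set.mem_singleton_iff, Set.mem_image, Set.mem_ofPred_eq]
  constructor
  · intro hX
    obtain ⟨s', u', v', hsu', hrep⟩ := X.exists_rep_eq
    rw [D.extendedTwistorLift_quadricPoint, D.extendedTwistorLift_eq hsu' hrep] at hX
    obtain ⟨a, ha⟩ := (Projectivization.mk_eq_mk_iff' ℂ _ _ _ _).1 hX
    have e0 : a * s = s' := congrFun ha 0
    have e1 : a * u = u' := congrFun ha 1
    subst e0 e1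
    have ha0 : a ≠ 0 := by
      rintro rfl
      simp at hsu'
    rw [liftCoords_smul] at ha
    refine ⟨v', (smul_right_injective _ ha0 ha).symm, ?_⟩
    refine (Quadric.eq_quadricPoint (a := a) hsu ?_).symm
    rw [hrep]
    funext i
    fin_cases i <;> simp [quadricCoords, mul_assoc]
  · rintro ⟨v', hv', rfl⟩
    rw [D.extendedTwistorLift_quadricPoint, D.extendedTwistorLift_quadricPoint]
    simp only [hv']

end SlicePoly

/-! ### The theorem. -/

theorem corollary4p6
    (P Pv : Quaternion ℝ → Quaternion ℝ)
    (hP : SlicePoly.IsSlicePolynomial P)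
    (hPv : SlicePoly.IsCompanion P Pv)
    (k : ℕ)
    (hk : SlicePoly.GenericallyToOne (SlicePoly.extendedTwistorLift P Pv) k) :
    ∃ (n : ℕ) (F : MvPolynomial (Fin 4) ℂ),
      k * n = SlicePoly.twistorDegree P ∧
      F.IsHomogeneous n ∧ Irreducible F ∧
      ∀ X : SlicePoly.Quadric,
        MvPolynomial.eval (SlicePoly.extendedTwistorLift P Pv X).rep F = 0 := by
  open SlicePoly in
  obtain ⟨x, g, g', h, h', D⟩ := hPv.exists_liftData
  obtain ⟨hg, hg', hh, hh', hw, hd⟩ := D.splitsAs.twistorDegree_eq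
  obtain ⟨G, m, hGm, ⟨X₀, hX₀⟩, hfib⟩ := hk
  obtain ⟨s₀, u₀, v₀, hsu₀, hrep₀⟩ := X₀.exists_rep_eq
  have hG₀ : MvPolynomial.eval (liftCoords g g' h h' s₀ u₀ v₀) G ≠ 0 := by
    rwa [D.extendedTwistorLift_eq hsu₀ hrep₀, Ne, eval_rep_mk_eq_zero_iff hGm] at hX₀
  have hcard : ∀ s u v, ¬ (s = 0 ∧ u = 0) →
      MvPolynomial.eval (liftCoords g g' h h' s u v) G ≠ 0 →
      {v' | liftCoords g g' h h' s u v' = liftCoords g g' h h' s u v}.encard = k := by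
    intro s u v hsu hG
    rw [← D.encard_fibre hsu]
    refine hfib _ ⟨_, rfl⟩ ?_
    rwa [D.extendedTwistorLift_quadricPoint, Ne, eval_rep_mk_eq_zero_iff hGm]
  -- In degree zero the lift does not depend on `v`, so its fibres are infinite, against the
  -- finiteness of `k`.
  have hd0 : twistorDegree P ≠ 0 := by
    intro h0
    rw [h0, Nat.le_zero] at hg hg' hh hh'
    rw [Polynomial.natDegree_eq_zero] at hg hg' hh hh'
    obtain ⟨c, rfl⟩ := hg
    obtain ⟨c', rfl⟩ := hg'
    obtain ⟨e, rfl⟩ := hh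
    obtain ⟨e', rfl⟩ := hh'
    have h1 := hcard s₀ u₀ v₀ hsu₀ hG₀
    have h2 : {v' | liftCoords (.C c) (.C c') (.C e) (.C e') s₀ u₀ v' =
        liftCoords (.C c) (.C c') (.C e) (.C e') s₀ u₀ v₀} = Set.univ := by
      ext v'
      simp [liftCoords]
    rw [h2, Set.infinite_univ.encard_eq] at h1
    exact ENat.natCast_ne_top k h1.symm
  obtain ⟨n, F, hkn, hFh, hFi, hF⟩ := exists_surface_of_generic_fibre hd0 hg hg' hh hh' hw
    (hd hd0) ⟨s₀, u₀, v₀, hG₀⟩ fun s u v hu hG => hcard s u v (fun h0 => hu h0.2) hG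
  refine ⟨n, F, hkn, hFh, hFi, fun X => ?_⟩
  obtain ⟨s, u, v, hsu, hrep⟩ := X.exists_rep_eq
  rw [D.extendedTwistorLift_eq hsu hrep, eval_rep_mk_eq_zero_iff hFh]
  exact hF s u v
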